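/- Let $K$ be an algebraically closed field of characteristic $\neq 2$. A Jordan algebra over $K$ is a $K$-vector space $J$ with a symmetric bilinear product $\circ$ such that $x^2\circ(x\circ y)=x\circ(x^2\circ y)$ for all $x,y\in J$, where $x^2=x\circ x$. It is nilpotent if $c^n(J)=0$ for some $n$, where $c^1(J)=J$ and $c^{m+1}(J)$ is the span of all $x\circ y$ with $x\in c^m(J)$, $y\in J$. Its centre is $Z(J)=\{x\in J: x\circ y=0 \text{ for all } y\in J\}$. We say that $J$ has a central component if $J=I_1\oplus I_2$ is the direct sum of two ideals with $0\neq I_2\subseteq Z(J)$. Consider the following commutative algebras with basis $a,b,c,d$, where products of basis vectors that are not listed (and do not follow by commutativity) are zero: - $J_{4,1}$: all products are zero; - $J_{4,2}$: $a^2=b$; - $J_{4,3}$: $a^2=c,\ b^2=c$; - $J_{4,4}$: $a^2=b,\ a\circ b=c$; - $J_{4,5}$: $a^2=d,\ b^2=d,\ c^2=d$; - $J_{4,6}$: $a^2=b,\ b\circ c=d$; - $J_{4,7}$: $a^2=b,\ a\circ b=d,\ c^2=d$; - $J_{4,8}$: $a^2=c,\ b^2=c,\ a\circ c=d$; - $J_{4,9}$: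 $a^2=c,\ b^2=-c,\ a\circ c=d,\ b\circ c=d$; - $J_{4,10}$: $a^2=c,\ b^2=-c,\ a\circ c=d,\ b\circ c=d,\ a\circ b=d$; - $J_{4,11}$: $a^2=b,\ a\circ b=c,\ a\circ c=d,\ b^2=d$; - $J_{4,12}$: $a^2=c,\ a\circ b=d$; - $J_{4,13}$: $a^2=c,\ b^2=c,\ a\circ b=d$. Then $J_{4,1},\dots,J_{4,13}$ are nilpotent Jordan algebras of dimension $4$ over $K$, they are pairwise non-isomorphic, and every nilpotent Jordan algebra of dimension $4$ over $K$ is isomorphic to one of them; so there are exactly $13$ isomorphism classes. Moreover, for $i=1,2,3,4$ one has $J_{4,i}\cong J_{3,i}\oplus J_{1,1}$, where $J_{1,1}$ is the one-dimensional algebra with zero product and $J_{3,i}$ is the algebra with basis $a,b,c$ and the same list of products as $J_{4,i}$. The algebras $J_{4,1},\dots,J_{4,4}$ have a central component, and $J_{4,5},\dots,J_{4,13}$ do not. -/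

import Mathlib

/-! Non-associative commutative `K`-algebras, i.e. `K`-vector spaces with a symmetric bilinear
product, are given by Mathlib's `[NonUnitalNonAssocCommRing A] [Module K A] [SMulCommClass K A A]
[IsScalarTower K A A]`; the Jordan identity is Mathlib's `IsCommJordan A`. -/

namespace NilpotentJordan

section Notions

/-- Isomorphism of algebras: a linear bijection that respects the products. -/
def Isomorphic (K : Type*) [Field K] (A : Type*) [NonUnitalNonAssocRing A] [Module K A]
    (B : Type*) [NonUnitalNonAssocRing B] [Module K B] : Prop :=
  ∃ e : A ≃ₗ[K] B, ∀ x y : A, e (x * y) = e x * e y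

variable (K : Type*) [Field K]
variable (A : Type*) [NonUnitalNonAssocCommRing A] [Module K A]

/-- The lower central series, indexed from `0`: `lowerCentral K A m` is `c^{m+1}(A)`, where
`c^1(A) = A` and `c^{m+1}(A)` is spanned by the products of `c^m(A)` with `A`. -/
def lowerCentral : ℕ → Submodule K A
  | 0 => ⊤
  | m + 1 => Submodule.span K {z | ∃ x ∈ lowerCentral m, ∃ y : A, z = x * y}

/-- `A` is nilpotent: its lower central series reaches `0`. -/
def Nilpotent : Prop := ∃ m : ℕ, lowerCentral K A m = ⊥

variable {K A}

/-- A subspace is an ideal (the product is commutative, so one side suffices). -/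
def IsIdeal (I : Submodule K A) : Prop := ∀ x ∈ I, ∀ y : A, x * y ∈ I

variable (K A)

/-- `A` has a central component: it is the direct sum of two ideals `I₁`, `I₂`, where `I₂` is
nonzero and contained in the centre `Z(A) = {x | x y = 0 for all y}`. -/
def HasCentralComponent : Prop :=
  ∃ I₁ I₂ : Submodule K A, IsIdeal I₁ ∧ IsIdeal I₂ ∧ IsCompl I₁ I₂ ∧ I₂ ≠ ⊥ ∧
    ∀ x ∈ I₂, ∀ y : A, x * y = 0

end Notions

section Tables

/-- One line of a multiplication table on a basis `e_0, …, e_{n-1}`: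
`e_i * e_j = e_j * e_i = coef • e_k`. -/
structure Line (n : ℕ) where
  i : Fin n
  j : Fin n
  coef : ℤ
  k : Fin n

/-- The coefficient contributed by `e_i * e_j = e_j * e_i` to the product of `x` and `y`:
`x_i y_i` if `i = j`, and `x_i y_j + x_j y_i` if `i ≠ j`. -/
def symCoeff {K : Type*} [Field K] {n : ℕ} (i j : Fin n) (x y : Fin n → K) : K :=
  if i = j then x i * y i else x i * y j + x j * y i

/-- The commutative algebra over `K` with basis `e_0, …, e_{n-1}` and multiplication table `L`
(products of basis vectors that are not listed are zero). -/
def TableAlgebra (K : Type*) {n : ℕ} (_L : List (Line n)) : Type _ := Fin n → K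

variable {K : Type*} [Field K] {n : ℕ} (L : List (Line n))

instance : AddCommGroup (TableAlgebra K L) := inferInstanceAs (AddCommGroup (Fin n → K))

instance : Module K (TableAlgebra K L) := inferInstanceAs (Module K (Fin n → K))

/-- The product of two coordinate vectors according to the table `L`. -/
def tableMul (x y : Fin n → K) : Fin n → K :=
  (L.map fun l => Pi.single l.k ((l.coef : K) * symCoeff l.i l.j x y)).sum

instance : Mul (TableAlgebra K L) := ⟨fun x y => tableMul L x y⟩

theorem symCoeff_comm (i j : Fin n) (x y : Fin n → K) : symCoeff i j x y = symCoeff i j y x := by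
  unfold symCoeff; split_ifs <;> ring

theorem symCoeff_add (i j : Fin n) (x y z : Fin n → K) :
    symCoeff i j x (y + z) = symCoeff i j x y + symCoeff i j x z := by
  unfold symCoeff; split_ifs <;> simp only [Pi.add_apply] <;> ring

theorem symCoeff_smul (i j : Fin n) (r : K) (x y : Fin n → K) :
    symCoeff i j x (r • y) = r * symCoeff i j x y := by
  unfold symCoeff; split_ifs <;> simp only [Pi.smul_apply, smul_eq_mul] <;> ring

theorem tableMul_comm (x y : Fin n → K) : tableMul L x y = tableMul L y x := by
  unfold tableMul; simp only [symCoeff_comm _ _ x y]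

theorem tableMul_add (x y z : Fin n → K) :
    tableMul L x (y + z) = tableMul L x y + tableMul L x z := by
  unfold tableMul
  rw [← List.sum_map_add]
  simp only [symCoeff_add, mul_add, Pi.single_add]

theorem tableMul_smul (r : K) (x y : Fin n → K) :
    tableMul L x (r • y) = r • tableMul L x y := by
  unfold tableMul
  rw [List.smul_sum, List.map_map]
  simp only [symCoeff_smul, Function.comp_def, ← Pi.single_smul, smul_eq_mul, mul_left_comm]

theorem tableMul_zero (x : Fin n → K) : tableMul L x 0 = 0 := by
  have h := tableMul_smul L (0 : K) x 0
  rwa [zero_smul, zero_smul] at h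

instance : NonUnitalNonAssocCommRing (TableAlgebra K L) where
  left_distrib x y z := tableMul_add L x y z
  right_distrib x y z :=
    (tableMul_comm L _ z).trans ((tableMul_add L z x y).trans
      (congrArg₂ _ (tableMul_comm L z x) (tableMul_comm L z y)))
  zero_mul x := (tableMul_comm L _ x).trans (tableMul_zero L x)
  mul_zero x := tableMul_zero L x
  mul_comm x y := tableMul_comm L x y

instance : SMulCommClass K (TableAlgebra K L) (TableAlgebra K L) where
  smul_comm r x y := (tableMul_smul L r x y).symm

instance : IsScalarTower K (TableAlgebra K L) (TableAlgebra K L) where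
  smul_assoc r x y :=
    (tableMul_comm L _ y).trans ((tableMul_smul L r y x).trans
      (congrArg (r • ·) (tableMul_comm L y x)))

end Tables

/-- The multiplication tables of `J_{4,1}, …, J_{4,13}` on the basis `a, b, c, d`, which are the
basis vectors with the indices `0, 1, 2, 3`; `J_{4,i}` has the index `i - 1`. -/
def table4 : Fin 13 → List (Line 4)
  -- all products zero
  | 0 => []
  -- a² = b
  | 1 => [⟨0, 0, 1, 1⟩]
  -- a² = c, b² = c
  | 2 => [⟨0, 0, 1, 2⟩, ⟨1, 1, 1, 2⟩]
  -- a² = b, ab = c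
  | 3 => [⟨0, 0, 1, 1⟩, ⟨0, 1, 1, 2⟩]
  -- a² = d, b² = d, c² = d
  | 4 => [⟨0, 0, 1, 3⟩, ⟨1, 1, 1, 3⟩, ⟨2, 2, 1, 3⟩]
  -- a² = b, bc = d
  | 5 => [⟨0, 0, 1, 1⟩, ⟨1, 2, 1, 3⟩]
  -- a² = b, ab = d, c² = d
  | 6 => [⟨0, 0, 1, 1⟩, ⟨0, 1, 1, 3⟩, ⟨2, 2, 1, 3⟩]
  -- a² = c, b² = c, ac = d
  | 7 => [⟨0, 0, 1, 2⟩, ⟨1, 1, 1, 2⟩, ⟨0, 2, 1, 3⟩]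
  -- a² = c, b² = -c, ac = d, bc = d
  | 8 => [⟨0, 0, 1, 2⟩, ⟨1, 1, -1, 2⟩, ⟨0, 2, 1, 3⟩, ⟨1, 2, 1, 3⟩]
  -- a² = c, b² = -c, ac = d, bc = d, ab = d
  | 9 => [⟨0, 0, 1, 2⟩, ⟨1, 1, -1, 2⟩, ⟨0, 2, 1, 3⟩, ⟨1, 2, 1, 3⟩, ⟨0, 1, 1, 3⟩]
  -- a² = b, ab = c, ac = d, b² = d
  | 10 => [⟨0, 0, 1, 1⟩, ⟨0, 1, 1, 2⟩, ⟨0, 2, 1, 3⟩, ⟨1, 1, 1, 3⟩]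
  -- a² = c, ab = d
  | 11 => [⟨0, 0, 1, 2⟩, ⟨0, 1, 1, 3⟩]
  -- a² = c, b² = c, ab = d
  | 12 => [⟨0, 0, 1, 2⟩, ⟨1, 1, 1, 2⟩, ⟨0, 1, 1, 3⟩]

/-- The multiplication tables of `J_{3,1}, …, J_{3,4}` on the basis `a, b, c`. -/
def table3 : Fin 4 → List (Line 3)
  -- all products zero
  | 0 => []
  -- a² = b
  | 1 => [⟨0, 0, 1, 1⟩]
  -- a² = c, b² = c
  | 2 => [⟨0, 0, 1, 2⟩, ⟨1, 1, 1, 2⟩]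
  -- a² = b, ab = c
  | 3 => [⟨0, 0, 1, 1⟩, ⟨0, 1, 1, 2⟩]

/-- The algebra `J_{4,i+1}` over `K`. -/
abbrev J4 (K : Type*) (i : Fin 13) : Type _ := TableAlgebra K (table4 i)

/-- The algebra `J_{3,i+1}` over `K`. -/
abbrev J3 (K : Type*) (i : Fin 4) : Type _ := TableAlgebra K (table3 i)

/-- The one-dimensional algebra `J_{1,1}` over `K`, with zero product. -/
abbrev J1 (K : Type*) : Type _ := TableAlgebra K ([] : List (Line 1))

end NilpotentJordan

/-! Existence. In a nilpotent algebra a nonzero ideal `I` is strictly larger than the span of `I *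
J`, so any hyperplane of `I` containing that span is again an ideal. Iterating gives a full flag,
hence a basis `a, b, c, d` with `d` annihilating everything and strictly triangular products
(`exists_hyperplane_ideal`, `exists_triangular_frame`). If `a²` has a `b`-component, `b` is replaced
by `a²`; either `a³` supplies `c`, and the powers of `a` determine the algebra
(`classified_of_powers`), or `a³` is a multiple of `d`, which is the rank one case below. Otherwise
all products of `a, b` lie in the span of `c, d`, and their `c`-coefficients form a binary quadratic
form (`classified_of_two_step`). Rank 0 leaves a ternary form with values in `K d`
(`classified_of_form`), rank 1 gives `a² = c` (`classified_of_rank_one`), rank 2 gives `a * b = c`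
(`classified_of_hyperbolic`). In each case the Jordan identity forces the remaining product `c²` to
vanish where needed, and explicit base changes reach a normal form, using square roots and division
by 2.

Distinctness. Properties expressed by products and zero alone, together with the existence of a
central component, are evaluated on all thirteen tables; their truth values separate every pair
(`not_isomorphic_J4`). -/

namespace NilpotentJordan

/-! ### Strictly triangular tables and nilpotency. -/

section TableAlgebra

variable {K : Type*} [Field K] {n : ℕ} {L : List (Line n)}

theorem tableMul_apply (L : List (Line n)) (x y : Fin n → K) (i : Fin n) :
    tableMul L x y i =
      (L.map fun l => if i = l.k then (l.coef : K) * symCoeff l.i l.j x y else 0).sum := by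
  unfold tableMul
  induction L with
  | nil => rfl
  | cons l L ih => simp [Pi.single_apply, ih]

/-- The elements whose first `m` coordinates vanish. -/
def tailSubmodule (L : List (Line n)) (m : ℕ) : Submodule K (TableAlgebra K L) where
  carrier := {x : Fin n → K | ∀ i : Fin n, i.val < m → x i = 0}
  add_mem' {x y} hx hy i hi := by
    change (x : Fin n → K) i + (y : Fin n → K) i = 0
    rw [hx i hi, hy i hi, add_zero]
  zero_mem' _ _ := rfl
  smul_mem' r x hx i hi := by
    change r * (x : Fin n → K) i = 0
    rw [hx i hi, mul_zero]

/-- Each table line outputs a basis vector of larger index than both its factors, so multiplication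
pushes the first nonzero coordinate to the right. -/
theorem mul_mem_tailSubmodule (hL : ∀ l ∈ L, l.i < l.k ∧ l.j < l.k) {m : ℕ}
    {x : TableAlgebra K L} (hx : x ∈ tailSubmodule L m) (y : TableAlgebra K L) :
    x * y ∈ tailSubmodule L (m + 1) := by
  intro i hi
  refine (tableMul_apply L x y i).trans (List.sum_eq_zero fun z hz => ?_)
  obtain ⟨l, hl, rfl⟩ := List.mem_map.1 hz
  obtain ⟨h1, h2⟩ := hL l hl
  split_ifs with hik
  · subst hik
    have hxi := hx l.i (by have := Fin.lt_def.1 h1; omega)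
    have hxj := hx l.j (by have := Fin.lt_def.1 h2; omega)
    simp [symCoeff, hxi, hxj]
  · rfl

theorem nilpotent_tableAlgebra (hL : ∀ l ∈ L, l.i < l.k ∧ l.j < l.k) :
    Nilpotent K (TableAlgebra K L) := by
  have key : ∀ m, lowerCentral K (TableAlgebra K L) m ≤ tailSubmodule L m := by
    intro m
    induction m with
    | zero => exact fun x _ i hi => absurd hi (Nat.not_lt_zero _)
    | succ m ih =>
      refine Submodule.span_le.2 ?_
      rintro _ ⟨x, hx, y, rfl⟩
      exact mul_mem_tailSubmodule hL (ih hx) y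
  exact ⟨n, (Submodule.eq_bot_iff _).2 fun x hx => funext fun i => key n hx i i.2⟩

theorem finrank_tableAlgebra : Module.finrank K (TableAlgebra K L) = n :=
  Module.finrank_fin_fun K

end TableAlgebra

/-! ### Central components: invariance and an obstruction. -/

section Invariants

variable {K : Type*} [Field K] {A B : Type*} [NonUnitalNonAssocCommRing A] [Module K A]
  [NonUnitalNonAssocCommRing B] [Module K B]

theorem Isomorphic.symm (h : Isomorphic K A B) : Isomorphic K B A := by
  obtain ⟨e, he⟩ := h
  exact ⟨e.symm, fun x y => e.injective (by simp [he])⟩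

theorem HasCentralComponent.of_isomorphic (h : Isomorphic K A B)
    (hA : HasCentralComponent K A) : HasCentralComponent K B := by
  obtain ⟨e, he⟩ := h
  obtain ⟨I₁, I₂, h₁, h₂, hc, h0, hz⟩ := hA
  have hI : ∀ I : Submodule K A, IsIdeal I → IsIdeal (I.map e.toLinearMap) := by
    rintro I hI _ ⟨x, hx, rfl⟩ y
    exact ⟨x * e.symm y, hI x hx _, by simp [he]⟩
  refine ⟨I₁.map e.toLinearMap, I₂.map e.toLinearMap, hI _ h₁, hI _ h₂,
    hc.map (Submodule.orderIsoMapComap e), ?_, ?_⟩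
  · rwa [Ne, Submodule.map_eq_bot_iff]
  · rintro _ ⟨x, hx, rfl⟩ y
    have := he x (e.symm y)
    rw [hz x hx, map_zero] at this
    simpa using this.symm

/-- Since `I₂` is central, every product lies in `I₁`. If central elements are sums of products,
then `I₂` lies in `I₁`, hence is zero. Two products suffice for the algebras considered, whose
centre has dimension at most two. -/
theorem not_hasCentralComponent
    (h : ∀ z : A, (∀ y, z * y = 0) → ∃ x y x' y' : A, z = x * y + x' * y') :
    ¬ HasCentralComponent K A := by
  rintro ⟨I₁, I₂, h₁, -, hc, h0, hz⟩
  have hmul : ∀ x y : A, x * y ∈ I₁ := by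
    intro x y
    have hx : x ∈ I₁ ⊔ I₂ := hc.sup_eq_top ▸ Submodule.mem_top
    obtain ⟨a, ha, b, hb, rfl⟩ := Submodule.mem_sup.1 hx
    rw [add_mul, hz b hb, add_zero]
    exact h₁ a ha y
  refine h0 ((Submodule.eq_bot_iff _).2 fun z hz₂ => ?_)
  obtain ⟨x, y, x', y', hxy⟩ := h z (hz z hz₂)
  exact Submodule.disjoint_def.1 hc.disjoint z (hxy ▸ I₁.add_mem (hmul _ _) (hmul _ _)) hz₂

end Invariants

/-! ### The thirteen algebras in coordinates. -/

section J4

variable {K : Type*} [Field K]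

/-- The product of `J_{4,i+1}` in coordinates. -/
def mul4 (i : Fin 13) (x y : Fin 4 → K) : Fin 4 → K :=
  match i with
  | 0 => ![0, 0, 0, 0]
  | 1 => ![0, x 0 * y 0, 0, 0]
  | 2 => ![0, 0, x 0 * y 0 + x 1 * y 1, 0]
  | 3 => ![0, x 0 * y 0, x 0 * y 1 + x 1 * y 0, 0]
  | 4 => ![0, 0, 0, x 0 * y 0 + x 1 * y 1 + x 2 * y 2]
  | 5 => ![0, x 0 * y 0, 0, x 1 * y 2 + x 2 * y 1]
  | 6 => ![0, x 0 * y 0, 0, x 0 * y 1 + x 1 * y 0 + x 2 * y 2]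
  | 7 => ![0, 0, x 0 * y 0 + x 1 * y 1, x 0 * y 2 + x 2 * y 0]
  | 8 => ![0, 0, x 0 * y 0 - x 1 * y 1, x 0 * y 2 + x 2 * y 0 + (x 1 * y 2 + x 2 * y 1)]
  | 9 => ![0, 0, x 0 * y 0 - x 1 * y 1,
      x 0 * y 2 + x 2 * y 0 + (x 1 * y 2 + x 2 * y 1) + (x 0 * y 1 + x 1 * y 0)]
  | 10 => ![0, x 0 * y 0, x 0 * y 1 + x 1 * y 0, x 0 * y 2 + x 2 * y 0 + x 1 * y 1]
  | 11 => ![0, 0, x 0 * y 0, x 0 * y 1 + x 1 * y 0]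
  | 12 => ![0, 0, x 0 * y 0 + x 1 * y 1, x 0 * y 1 + x 1 * y 0]

theorem tableMul_table4 (i : Fin 13) (x y : Fin 4 → K) :
    tableMul (table4 i) x y = mul4 i x y := by
  funext k
  rw [tableMul_apply]
  fin_cases i <;> fin_cases k <;> simp [table4, mul4, symCoeff] <;> ring

theorem J4_mul (i : Fin 13) (x y : J4 K i) : x * y = mul4 i x y := tableMul_table4 i x y

theorem isCommJordan_J4 (i : Fin 13) : IsCommJordan (J4 K i) := by
  let T := tableMul (K := K) (table4 i)
  refine ⟨fun (x y : Fin 4 → K) => ?_⟩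
  change T (T x y) (T x x) = T x (T y (T x x))
  simp only [T, tableMul_table4]
  fin_cases i <;> (funext k; fin_cases k <;> simp [mul4] <;> ring)

theorem nilpotent_J4 (i : Fin 13) : Nilpotent K (J4 K i) :=
  nilpotent_tableAlgebra (by fin_cases i <;> simp [table4])

theorem isomorphic_J4_prod (i : Fin 4) :
    Isomorphic K (J4 K (Fin.castLE (by norm_num) i)) (J3 K i × J1 K) := by
  let e : (Fin 4 → K) ≃ₗ[K] (Fin 3 → K) × (Fin 1 → K) :=
    { toFun := fun x => (![x 0, x 1, x 2], ![x 3])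
      invFun := fun p => ![p.1 0, p.1 1, p.1 2, p.2 0]
      map_add' := fun x y => by ext k <;> fin_cases k <;> rfl
      map_smul' := fun r x => by ext k <;> fin_cases k <;> rfl
      left_inv := fun x => by ext k; fin_cases k <;> rfl
      right_inv := fun p => by ext k <;> fin_cases k <;> rfl }
  refine ⟨e, fun (x y : Fin 4 → K) => ?_⟩
  change e (tableMul _ x y) = (tableMul (table3 i) (e x).1 (e y).1, tableMul [] (e x).2 (e y).2)
  rw [tableMul_table4]
  refine Prod.ext (funext fun k => ?_) (funext fun k => ?_)
  · dsimp only
    rw [tableMul_apply]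
    fin_cases i <;> fin_cases k <;> simp [e, mul4, table3, symCoeff]
  · dsimp only
    rw [tableMul_apply]
    fin_cases i <;> fin_cases k <;> simp [e, mul4]

theorem hasCentralComponent_J4 (i : Fin 13) (hi : i.val < 4) :
    HasCentralComponent K (J4 K i) := by
  -- In the first four tables `d` occurs neither as a factor nor as a value, so the line `K d`
  -- splits off.
  let I₁ : Submodule K (Fin 4 → K) := LinearMap.ker (LinearMap.proj 3)
  let I₂ : Submodule K (Fin 4 → K) := Submodule.span K {Pi.single 3 1}
  have mul3 : ∀ x y : Fin 4 → K, mul4 i x y ∈ I₁ := by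
    intro x y
    fin_cases i <;> first | (simp at hi; done) | simp [I₁, mul4]
  have hz : ∀ x ∈ I₂, ∀ y : Fin 4 → K, mul4 i x y = 0 := by
    intro x hx y
    obtain ⟨r, rfl⟩ := Submodule.mem_span_singleton.1 hx
    fin_cases i <;> first | (simp at hi; done) | (ext k; fin_cases k <;> simp [mul4])
  have hc : IsCompl I₁ I₂ := by
    refine ⟨Submodule.disjoint_def.2 fun x h₁ h₂ => ?_, codisjoint_iff.2 (eq_top_iff.2
      fun x _ => Submodule.mem_sup.2 ⟨x - x 3 • Pi.single 3 1, ?_, x 3 • Pi.single 3 1,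
        Submodule.mem_span_singleton.2 ⟨_, rfl⟩, sub_add_cancel _ _⟩)⟩
    · obtain ⟨r, rfl⟩ := Submodule.mem_span_singleton.1 h₂
      have : r = 0 := by simpa [I₁] using h₁
      rw [this, zero_smul]
    · simp [I₁]
  have h0 : I₂ ≠ ⊥ := by simp [I₂]
  exact ⟨I₁, I₂, fun x _ y => (J4_mul i x y).symm ▸ mul3 x y,
    fun x hx y => (J4_mul i x y).symm ▸ hz x hx y ▸ I₂.zero_mem, hc, h0,
    fun x hx y => (J4_mul i x y).trans (hz x hx y)⟩

end J4

/-! ### Algebras without central component. -/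

section Nonisomorphic

variable {K : Type*} [Field K]

theorem not_hasCentralComponent_J4 (i : Fin 13) (hi : ¬ i.val < 4) :
    ¬ HasCentralComponent K (J4 K i) := by
  refine not_hasCentralComponent ?_
  change ∀ z : Fin 4 → K, (∀ y : Fin 4 → K, tableMul (table4 i) z y = 0) →
    ∃ x y x' y' : Fin 4 → K, z = tableMul (table4 i) x y + tableMul (table4 i) x' y'
  simp only [tableMul_table4]
  intro z hz
  have ha := hz (Pi.single 0 1)
  have hb := hz (Pi.single 1 1)
  have hc := hz (Pi.single 2 1)
  clear hz
  fin_cases i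
  all_goals first | (simp at hi; done) | skip
  all_goals simp [mul4] at ha hb hc
  · exact ⟨Pi.single 0 (z 3), Pi.single 0 1, 0, 0, by ext k; fin_cases k <;> simp [mul4, *]⟩
  · exact ⟨Pi.single 1 (z 3), Pi.single 2 1, 0, 0, by ext k; fin_cases k <;> simp [mul4, *]⟩
  · exact ⟨Pi.single 0 (z 3), Pi.single 1 1, 0, 0, by ext k; fin_cases k <;> simp [mul4, *]⟩
  · exact ⟨Pi.single 0 (z 3), Pi.single 2 1, 0, 0, by ext k; fin_cases k <;> simp [mul4, *]⟩
  · exact ⟨Pi.single 0 (z 3), Pi.single 2 1, 0, 0, by ext k; fin_cases k <;> simp [mul4, *]⟩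
  · have h2 : z 2 = 0 := by linear_combination hb.2 - ha.1
    exact ⟨Pi.single 0 (z 3), Pi.single 2 1, 0, 0, by ext k; fin_cases k <;> simp [mul4, *]⟩
  · exact ⟨Pi.single 0 (z 3), Pi.single 2 1, 0, 0, by ext k; fin_cases k <;> simp [mul4, *]⟩
  · exact ⟨Pi.single 0 (z 2), Pi.single 0 1, Pi.single 0 (z 3), Pi.single 1 1, by
      ext k; fin_cases k <;> simp [mul4, *]⟩
  · exact ⟨Pi.single 0 (z 2), Pi.single 0 1, Pi.single 0 (z 3), Pi.single 1 1, by
      ext k; fin_cases k <;> simp [mul4, *]⟩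

theorem hasCentralComponent_J4_iff (i : Fin 13) :
    HasCentralComponent K (J4 K i) ↔ i.val < 4 :=
  ⟨not_imp_not.1 (not_hasCentralComponent_J4 i), hasCentralComponent_J4 i⟩

theorem Isomorphic.exists_equiv {i j : Fin 13} (h : Isomorphic K (J4 K i) (J4 K j)) :
    ∃ e : (Fin 4 → K) ≃ (Fin 4 → K), (∀ x, e x = 0 ↔ x = 0) ∧
      ∀ x y, e (mul4 i x y) = mul4 j (e x) (e y) := by
  obtain ⟨e, he⟩ := h
  refine ⟨e.toEquiv, fun x => e.map_eq_zero_iff, fun x y => ?_⟩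
  exact (congrArg e (J4_mul i x y).symm).trans ((he x y).trans (J4_mul j _ _))

end Nonisomorphic

/-! ### Invariants expressed by products and zero. -/

section Invariants

variable {V W : Type*} [Zero V] [Zero W] (m : V → V → V)

/-- All products vanish. -/
def MulTrivial : Prop := ∀ x y, m x y = 0

/-- All products of three elements vanish. -/
def CubeTrivial : Prop := ∀ x y z, m (m x y) z = 0

/-- All products of four elements, bracketed from the left, vanish. -/
def FourthTrivial : Prop := ∀ x y z w, m (m (m x y) z) w = 0

/-- There is an element of square zero outside the annihilator. -/
def HasIsotropic : Prop := ∃ x, m x x = 0 ∧ ∃ y, m x y ≠ 0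

/-- Of two orthogonal elements, one has square zero. -/
def OrthogonalSq : Prop := ∀ x y, m x y = 0 → m x x = 0 ∨ m y y = 0

/-- Some `x` has `(x y) z = 0` for all `y`, `z`, but does not annihilate all products. -/
def HasLeftNotRight : Prop := ∃ x, (∀ y z, m (m x y) z = 0) ∧ ∃ y z, m x (m y z) ≠ 0

/-- Some `x` has `(x y) z = 0` for all `y`, `z`, but `x² ≠ 0`. -/
def HasLeftNotSq : Prop := ∃ x, (∀ y z, m (m x y) z = 0) ∧ m x x ≠ 0

/-- Some `x` annihilates all products, but `x²` is not in the annihilator. -/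
def HasRightNotSq : Prop := ∃ x, (∀ y z, m x (m y z) = 0) ∧ ∃ z, m (m x x) z ≠ 0

/-- Some `x` annihilates all products, has `x² = 0`, but `(x y) z ≠ 0` for some `y`, `z`. -/
def HasRightNotLeft : Prop :=
  ∃ x, (∀ y z, m x (m y z) = 0) ∧ m x x = 0 ∧ ∃ y z, m (m x y) z ≠ 0

theorem properties_congr {m : V → V → V} {m' : W → W → W} (e : V ≃ W)
    (h0 : ∀ x, e x = 0 ↔ x = 0) (hm : ∀ x y, e (m x y) = m' (e x) (e y)) :
    (MulTrivial m ↔ MulTrivial m') ∧ (CubeTrivial m ↔ CubeTrivial m') ∧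
    (FourthTrivial m ↔ FourthTrivial m') ∧ (HasIsotropic m ↔ HasIsotropic m') ∧
    (OrthogonalSq m ↔ OrthogonalSq m') ∧ (HasLeftNotRight m ↔ HasLeftNotRight m') ∧
    (HasLeftNotSq m ↔ HasLeftNotSq m') ∧ (HasRightNotSq m ↔ HasRightNotSq m') ∧
    (HasRightNotLeft m ↔ HasRightNotLeft m') := by
  have h2 : ∀ x y, m x y = 0 ↔ m' (e x) (e y) = 0 := fun x y => by rw [← hm, h0]
  have h3 : ∀ x y z, m (m x y) z = 0 ↔ m' (m' (e x) (e y)) (e z) = 0 := fun x y z => by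
    rw [← hm, ← hm, h0]
  have h3' : ∀ x y z, m x (m y z) = 0 ↔ m' (e x) (m' (e y) (e z)) = 0 := fun x y z => by
    rw [← hm, ← hm, h0]
  refine ⟨?_, ?_, ?_, ?_, ?_, ?_, ?_, ?_, ?_⟩
  · exact e.forall_congr fun x => e.forall_congr fun y => h2 x y
  · exact e.forall_congr fun x => e.forall_congr fun y => e.forall_congr fun z => h3 x y z
  · exact e.forall_congr fun x => e.forall_congr fun y => e.forall_congr fun z =>
      e.forall_congr fun w => by rw [← hm, ← hm, ← hm, h0]
  · exact e.exists_congr fun x => and_congr (h2 x x) <| e.exists_congr fun y => (h2 x y).not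
  · exact e.forall_congr fun x => e.forall_congr fun y => imp_congr (h2 x y) <|
      or_congr (h2 x x) (h2 y y)
  · exact e.exists_congr fun x => and_congr
      (e.forall_congr fun y => e.forall_congr fun z => h3 x y z)
      (e.exists_congr fun y => e.exists_congr fun z => (h3' x y z).not)
  · exact e.exists_congr fun x => and_congr
      (e.forall_congr fun y => e.forall_congr fun z => h3 x y z) (h2 x x).not
  · exact e.exists_congr fun x => and_congr
      (e.forall_congr fun y => e.forall_congr fun z => h3' x y z)
      (e.exists_congr fun z => (h3 x x z).not)
  · exact e.exists_congr fun x => and_congr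
      (e.forall_congr fun y => e.forall_congr fun z => h3' x y z) <| and_congr (h2 x x)
      (e.exists_congr fun y => e.exists_congr fun z => (h3 x y z).not)

end Invariants

/-! ### Values of the invariants on the thirteen algebras. -/

section Truth

variable {K : Type*} [Field K]

theorem mulTrivial_mul4_iff (i : Fin 13) :
    MulTrivial (mul4 (K := K) i) ↔ i ∈ ({0} : Finset (Fin 13)) := by
  fin_cases i
  · exact iff_of_true (fun x y => by simp [mul4]) (by decide)
  all_goals
    refine iff_of_false (fun h => ?_) (by decide)
    simpa [mul4] using h (Pi.single 0 1) (Pi.single 0 1)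

theorem cubeTrivial_mul4_iff (i : Fin 13) :
    CubeTrivial (mul4 (K := K) i) ↔ i ∈ ({0, 1, 2, 4, 11, 12} : Finset (Fin 13)) := by
  fin_cases i
  all_goals first
    | exact iff_of_true (fun x y z => by simp [mul4]) (by decide)
    | refine iff_of_false (fun h => ?_) (by decide)
      first
        | simpa [mul4] using h (Pi.single 0 1) (Pi.single 0 1) (Pi.single 0 1)
        | simpa [mul4] using h (Pi.single 0 1) (Pi.single 0 1) (Pi.single 2 1)

theorem fourthTrivial_mul4_iff (i : Fin 13) :
    FourthTrivial (mul4 (K := K) i) ↔ i ≠ 10 := by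
  fin_cases i
  all_goals first
    | exact iff_of_true (fun x y z w => by simp [mul4]) (by decide)
    | refine iff_of_false (fun h => ?_) (by decide)
      simpa [mul4] using h (Pi.single 0 1) (Pi.single 0 1) (Pi.single 0 1) (Pi.single 0 1)

theorem hasLeftNotRight_mul4_iff (i : Fin 13) :
    HasLeftNotRight (mul4 (K := K) i) ↔ i ∈ ({5} : Finset (Fin 13)) := by
  fin_cases i
  all_goals first
    | refine iff_of_false ?_ (by decide)
      rintro ⟨x, h, y, z, hx⟩
      refine hx ?_
      -- Testing against `(a, a)` and `(b, a)` already gives all the linear conditions on `x` that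
      -- are needed; the index where the property holds falls through to `skip`.
      have h1 := h (Pi.single 0 1) (Pi.single 0 1)
      have h2 := h (Pi.single 1 1) (Pi.single 0 1)
      clear h hx
      simp [mul4] at h1 h2 ⊢
      done
    | refine iff_of_false ?_ (by decide)
      rintro ⟨x, h, y, z, hx⟩
      refine hx ?_
      have h1 := h (Pi.single 0 1) (Pi.single 0 1)
      have h2 := h (Pi.single 1 1) (Pi.single 0 1)
      clear h hx
      simp [mul4] at h1 h2 ⊢
      simp [h1, h2]
    | skip
  exact iff_of_true ⟨Pi.single 2 1, fun y z => by simp [mul4], Pi.single 0 1, Pi.single 0 1,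
    by simp [mul4]⟩ (by decide)

theorem hasLeftNotSq_mul4_iff (i : Fin 13) (h2 : (2 : K) ≠ 0) :
    HasLeftNotSq (mul4 (K := K) i) ↔ i ∈ ({1, 2, 4, 5, 6, 11, 12} : Finset (Fin 13)) := by
  fin_cases i
  all_goals first
    | refine iff_of_false ?_ (by decide)
      rintro ⟨x, h, hx⟩
      refine hx ?_
      have h1 := h (Pi.single 0 1) (Pi.single 0 1)
      have h2 := h (Pi.single 1 1) (Pi.single 0 1)
      clear h hx
      simp [mul4] at h1 h2 ⊢
      done
    | refine iff_of_false ?_ (by decide)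
      rintro ⟨x, h, hx⟩
      refine hx ?_
      have h1 := h (Pi.single 0 1) (Pi.single 0 1)
      have h2 := h (Pi.single 1 1) (Pi.single 0 1)
      clear h hx
      simp [mul4] at h1 h2 ⊢
      simp [h1, h2]
    | skip
  · exact iff_of_true ⟨Pi.single 0 1, fun y z => by simp [mul4], by simp [mul4]⟩ (by decide)
  · exact iff_of_true ⟨Pi.single 0 1, fun y z => by simp [mul4], by simp [mul4]⟩ (by decide)
  · exact iff_of_true ⟨Pi.single 0 1, fun y z => by simp [mul4], by simp [mul4]⟩ (by decide)
  -- In `J_{4,6}` both `b` and `c` have square zero, but `(b + c)² = 2d`.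
  · exact iff_of_true ⟨Pi.single 1 1 + Pi.single 2 1, fun y z => by simp [mul4],
      by simpa [mul4, one_add_one_eq_two] using h2⟩ (by decide)
  · exact iff_of_true ⟨Pi.single 2 1, fun y z => by simp [mul4], by simp [mul4]⟩ (by decide)
  · exact iff_of_true ⟨Pi.single 0 1, fun y z => by simp [mul4], by simp [mul4]⟩ (by decide)
  · exact iff_of_true ⟨Pi.single 0 1, fun y z => by simp [mul4], by simp [mul4]⟩ (by decide)

theorem hasRightNotSq_mul4_iff (i : Fin 13) :
    HasRightNotSq (mul4 (K := K) i) ↔ i ∈ ({5, 7} : Finset (Fin 13)) := by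
  fin_cases i
  all_goals first
    | refine iff_of_false ?_ (by decide)
      rintro ⟨x, h, z, hx⟩
      refine hx ?_
      have h1 := h (Pi.single 0 1) (Pi.single 0 1)
      have h2 := h (Pi.single 1 1) (Pi.single 0 1)
      clear h hx
      simp [mul4] at h1 h2 ⊢
      done
    | refine iff_of_false ?_ (by decide)
      rintro ⟨x, h, z, hx⟩
      refine hx ?_
      have h1 := h (Pi.single 0 1) (Pi.single 0 1)
      have h2 := h (Pi.single 1 1) (Pi.single 0 1)
      clear h hx
      simp [mul4] at h1 h2 ⊢
      first | (simp [h1]; done) | simp [eq_neg_of_add_eq_zero_left h1]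
    | skip
  · exact iff_of_true ⟨Pi.single 0 1, fun y z => by simp [mul4], Pi.single 2 1,
      by simp [mul4]⟩ (by decide)
  · exact iff_of_true ⟨Pi.single 1 1, fun y z => by simp [mul4], Pi.single 0 1,
      by simp [mul4]⟩ (by decide)

theorem hasRightNotLeft_mul4_iff (i : Fin 13) (hK : (2 : K) ≠ 0) :
    HasRightNotLeft (mul4 (K := K) i) ↔ i ∈ ({8} : Finset (Fin 13)) := by
  fin_cases i
  all_goals first
    | refine iff_of_false ?_ (by decide)
      rintro ⟨x, h, hs, y, z, hx⟩
      refine hx ?_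
      have h1 := h (Pi.single 0 1) (Pi.single 0 1)
      have h2 := h (Pi.single 1 1) (Pi.single 0 1)
      clear h hx
      simp [mul4] at h1 h2 hs ⊢
      done
    | refine iff_of_false ?_ (by decide)
      rintro ⟨x, h, hs, y, z, hx⟩
      refine hx ?_
      have h1 := h (Pi.single 0 1) (Pi.single 0 1)
      have h2 := h (Pi.single 1 1) (Pi.single 0 1)
      clear h hx
      simp [mul4] at h1 h2 hs ⊢
      simp_all
      done
    | skip
  -- The element `a - b` kills `c`. Its square is zero in `J_{4,9}`, but `-2d` in `J_{4,10}` because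
  -- there `a * b = d`; this separates the two algebras.
  · refine iff_of_true ⟨Pi.single 0 1 - Pi.single 1 1, fun y z => by simp [mul4],
      by ext k; fin_cases k <;> simp [mul4], Pi.single 0 1, Pi.single 0 1, ?_⟩ (by decide)
    simp [mul4]
  · refine iff_of_false ?_ (by decide)
    rintro ⟨x, h, hs, y, z, hx⟩
    refine hx ?_
    have h1 := h (Pi.single 0 1) (Pi.single 0 1)
    clear h hx
    simp [mul4] at h1 hs ⊢
    have h0 : x 0 = -x 1 := eq_neg_of_add_eq_zero_left h1
    have h3 : 2 * (x 1 * x 1) = 0 := by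
      have := hs.2
      rw [h0] at this
      linear_combination -this
    have h4 : x 1 = 0 := by simpa [hK] using h3
    simp [h0, h4]

theorem hasIsotropic_mul4_iff (i : Fin 13) (h2 : (2 : K) ≠ 0) [IsAlgClosed K] :
    HasIsotropic (mul4 (K := K) i) ↔ i ∉ ({0, 1, 12} : Finset (Fin 13)) := by
  obtain ⟨r, hr⟩ := IsAlgClosed.exists_pow_nat_eq (-1 : K) two_pos
  have hr' : 1 + r * r = 0 := by linear_combination hr
  fin_cases i
  · exact iff_of_false (fun ⟨x, h, y, hy⟩ => hy (by simp [mul4])) (by decide)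
  · refine iff_of_false (fun ⟨x, h, y, hy⟩ => hy ?_) (by decide)
    simp [mul4] at h
    simp [mul4, h]
  · exact iff_of_true ⟨![1, r, 0, 0], by simp [mul4, hr'], Pi.single 0 1, by simp [mul4]⟩
      (by decide)
  · exact iff_of_true ⟨Pi.single 1 1, by simp [mul4], Pi.single 0 1, by simp [mul4]⟩ (by decide)
  · exact iff_of_true ⟨![1, r, 0, 0], by simp [mul4, hr'], Pi.single 0 1, by simp [mul4]⟩
      (by decide)
  · exact iff_of_true ⟨Pi.single 2 1, by simp [mul4], Pi.single 1 1, by simp [mul4]⟩ (by decide)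
  · exact iff_of_true ⟨Pi.single 1 1, by simp [mul4], Pi.single 0 1, by simp [mul4]⟩ (by decide)
  · exact iff_of_true ⟨Pi.single 2 1, by simp [mul4], Pi.single 0 1, by simp [mul4]⟩ (by decide)
  · exact iff_of_true ⟨Pi.single 2 1, by simp [mul4], Pi.single 0 1, by simp [mul4]⟩ (by decide)
  · exact iff_of_true ⟨Pi.single 2 1, by simp [mul4], Pi.single 0 1, by simp [mul4]⟩ (by decide)
  · exact iff_of_true ⟨Pi.single 2 1, by simp [mul4], Pi.single 0 1, by simp [mul4]⟩ (by decide)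
  · exact iff_of_true ⟨Pi.single 1 1, by simp [mul4], Pi.single 0 1, by simp [mul4]⟩ (by decide)
  · refine iff_of_false (fun ⟨x, h, y, hy⟩ => hy ?_) (by decide)
    simp [mul4] at h
    have h3 : 2 * (x 0 * x 1) = 0 := by linear_combination h.2
    have h4 : x 0 = 0 ∨ x 1 = 0 := by simpa [h2] using h3
    rcases h4 with h4 | h4 <;> simp [h4] at h <;> simp [mul4, h4, h]

/-- The conjunction with `CubeTrivial` restricts the computation to six algebras; its purpose is to
isolate `J_{4,12}` among those without central component. -/
theorem orthogonalSq_mul4_iff (i : Fin 13) (h2 : (2 : K) ≠ 0) :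
    CubeTrivial (mul4 (K := K) i) ∧ OrthogonalSq (mul4 (K := K) i) ↔
      i ∈ ({0, 1, 11} : Finset (Fin 13)) := by
  rw [cubeTrivial_mul4_iff]
  fin_cases i
  all_goals first
    | exact iff_of_false (fun h => absurd h.1 (by decide)) (by decide)
    | skip
  · exact iff_of_true ⟨by decide, fun x y _ => by simp [mul4]⟩ (by decide)
  · exact iff_of_true ⟨by decide, fun x y h => by simpa [mul4] using h⟩ (by decide)
  · refine iff_of_false (fun h => ?_) (by decide)
    simpa [mul4] using h.2 (Pi.single 0 1) (Pi.single 1 1) (by simp [mul4])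
  · refine iff_of_false (fun h => ?_) (by decide)
    simpa [mul4] using h.2 (Pi.single 0 1) (Pi.single 1 1) (by simp [mul4])
  · refine iff_of_true ⟨by decide, fun x y h => ?_⟩ (by decide)
    simp [mul4] at h
    rcases h.1 with h | h <;> simp [mul4, h]
  · refine iff_of_false (fun h => ?_) (by decide)
    -- `(a + b)(a - b) = a² - b² = 0`, while both squares have `c`-coefficient 2.
    simpa [mul4, one_add_one_eq_two, h2] using h.2 ![1, 1, 0, 0] ![1, -1, 0, 0] (by simp [mul4])

theorem not_isomorphic_J4 [IsAlgClosed K] (h2 : (2 : K) ≠ 0) {i j : Fin 13} (hij : i ≠ j) :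
    ¬ Isomorphic K (J4 K i) (J4 K j) := by
  intro h
  have hc : i.val < 4 ↔ j.val < 4 := by
    rw [← hasCentralComponent_J4_iff (K := K), ← hasCentralComponent_J4_iff (K := K)]
    exact ⟨.of_isomorphic h, .of_isomorphic h.symm⟩
  obtain ⟨e, h0, hm⟩ := h.exists_equiv
  obtain ⟨k1, k2, k3, k4, k5, k6, k7, k8, k9⟩ := properties_congr e h0 hm
  have k5' := and_congr k2 k5
  rw [mulTrivial_mul4_iff, mulTrivial_mul4_iff] at k1
  rw [cubeTrivial_mul4_iff, cubeTrivial_mul4_iff] at k2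
  rw [fourthTrivial_mul4_iff, fourthTrivial_mul4_iff] at k3
  rw [hasIsotropic_mul4_iff _ h2, hasIsotropic_mul4_iff _ h2] at k4
  rw [orthogonalSq_mul4_iff _ h2, orthogonalSq_mul4_iff _ h2] at k5'
  rw [hasLeftNotRight_mul4_iff, hasLeftNotRight_mul4_iff] at k6
  rw [hasLeftNotSq_mul4_iff _ h2, hasLeftNotSq_mul4_iff _ h2] at k7
  rw [hasRightNotSq_mul4_iff, hasRightNotSq_mul4_iff] at k8
  rw [hasRightNotLeft_mul4_iff _ h2, hasRightNotLeft_mul4_iff _ h2] at k9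
  clear k5 h0 hm e h h2
  -- What remains is a finite statement about memberships in subsets of `Fin 13`.
  revert i j
  decide

end Truth

/-! ### Bases, base change and recognition of a table. -/

section Frames

variable {K : Type*} [Field K] {J : Type*} [NonUnitalNonAssocCommRing J] [Module K J]

/-- Four vectors spanning an algebra of dimension four. -/
structure Frame (K : Type*) [Field K] {J : Type*} [NonUnitalNonAssocCommRing J] [Module K J]
    (a b c d : J) : Prop where
  finrank_eq : Module.finrank K J = 4
  span_eq : ∀ x : J, ∃ r s t u : K, x = r • a + s • b + t • c + u • d

/-- The algebra is isomorphic to one of the thirteen algebras. -/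
def Classified (K : Type*) [Field K] (J : Type*) [NonUnitalNonAssocCommRing J]
    [Module K J] : Prop := ∃ i : Fin 13, Isomorphic K J (J4 K i)

/-- Four spanning vectors in dimension four form a basis, so it is enough to write the old vectors
in terms of the new ones. -/
theorem Frame.change {a b c d a' b' c' d' : J} (h : Frame K a b c d)
    (ha : ∃ r s t u : K, a = r • a' + s • b' + t • c' + u • d')
    (hb : ∃ r s t u : K, b = r • a' + s • b' + t • c' + u • d')
    (hc : ∃ r s t u : K, c = r • a' + s • b' + t • c' + u • d')
    (hd : ∃ r s t u : K, d = r • a' + s • b' + t • c' + u • d') : Frame K a' b' c' d' := by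
  refine ⟨h.finrank_eq, fun x => ?_⟩
  obtain ⟨r, s, t, u, rfl⟩ := h.span_eq x
  obtain ⟨a0, a1, a2, a3, rfl⟩ := ha
  obtain ⟨b0, b1, b2, b3, rfl⟩ := hb
  obtain ⟨c0, c1, c2, c3, rfl⟩ := hc
  obtain ⟨d0, d1, d2, d3, rfl⟩ := hd
  exact ⟨r * a0 + s * b0 + t * c0 + u * d0, r * a1 + s * b1 + t * c1 + u * d1,
    r * a2 + s * b2 + t * c2 + u * d2, r * a3 + s * b3 + t * c3 + u * d3, by module⟩

theorem Frame.swap₀₁ {a b c d : J} (h : Frame K a b c d) : Frame K b a c d :=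
  ⟨h.1, fun x => by obtain ⟨r, s, t, u, rfl⟩ := h.2 x; exact ⟨s, r, t, u, by abel⟩⟩

theorem Frame.swap₁₂ {a b c d : J} (h : Frame K a b c d) : Frame K a c b d :=
  ⟨h.1, fun x => by obtain ⟨r, s, t, u, rfl⟩ := h.2 x; exact ⟨r, t, s, u, by abel⟩⟩

theorem Frame.swap₂₃ {a b c d : J} (h : Frame K a b c d) : Frame K a b d c :=
  ⟨h.1, fun x => by obtain ⟨r, s, t, u, rfl⟩ := h.2 x; exact ⟨r, s, u, t, by abel⟩⟩

theorem Frame.smul {a b c d : J} (h : Frame K a b c d) {p q r s : K} (hp : p ≠ 0) (hq : q ≠ 0)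
    (hr : r ≠ 0) (hs : s ≠ 0) : Frame K (p • a) (q • b) (r • c) (s • d) :=
  h.change ⟨p⁻¹, 0, 0, 0, by simp [smul_smul, hp]⟩ ⟨0, q⁻¹, 0, 0, by simp [smul_smul, hq]⟩
    ⟨0, 0, r⁻¹, 0, by simp [smul_smul, hr]⟩ ⟨0, 0, 0, s⁻¹, by simp [smul_smul, hs]⟩

/-- The linear combination of `a`, `b`, `c`, `d` with coefficients `x`. -/
def comb (a b c d : J) (x : Fin 4 → K) : J := x 0 • a + x 1 • b + x 2 • c + x 3 • d

variable [SMulCommClass K J J] [IsScalarTower K J J]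

theorem comb_mul_comb (a b c d : J) (x y : Fin 4 → K) :
    comb a b c d x * comb a b c d y =
      (x 0 * y 0) • (a * a) + (x 0 * y 1 + x 1 * y 0) • (a * b) +
      (x 0 * y 2 + x 2 * y 0) • (a * c) + (x 0 * y 3 + x 3 * y 0) • (a * d) +
      (x 1 * y 1) • (b * b) + (x 1 * y 2 + x 2 * y 1) • (b * c) +
      (x 1 * y 3 + x 3 * y 1) • (b * d) + (x 2 * y 2) • (c * c) +
      (x 2 * y 3 + x 3 * y 2) • (c * d) + (x 3 * y 3) • (d * d) := by
  simp only [comb, mul_add, add_mul, smul_mul_assoc, mul_smul_comm, mul_comm b a, mul_comm c a,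
    mul_comm d a, mul_comm c b, mul_comm d b, mul_comm d c]
  module

theorem Frame.classified {a b c d : J} (h : Frame K a b c d) (i : Fin 13)
    (haa : a * a = comb a b c d (mul4 (K := K) i (Pi.single 0 1) (Pi.single 0 1)))
    (hab : a * b = comb a b c d (mul4 (K := K) i (Pi.single 0 1) (Pi.single 1 1)))
    (hac : a * c = comb a b c d (mul4 (K := K) i (Pi.single 0 1) (Pi.single 2 1)))
    (hbb : b * b = comb a b c d (mul4 (K := K) i (Pi.single 1 1) (Pi.single 1 1)))
    (hbc : b * c = comb a b c d (mul4 (K := K) i (Pi.single 1 1) (Pi.single 2 1)))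
    (hcc : c * c = comb a b c d (mul4 (K := K) i (Pi.single 2 1) (Pi.single 2 1)))
    (had : a * d = 0) (hbd : b * d = 0) (hcd : c * d = 0) (hdd : d * d = 0) :
    Classified K J := by
  have hs : ⊤ ≤ Submodule.span K (Set.range ![a, b, c, d]) := by
    intro x _
    obtain ⟨r, s, t, u, rfl⟩ := h.2 x
    refine (Submodule.mem_span_range_iff_exists_fun K).2 ⟨![r, s, t, u], ?_⟩
    simp [Fin.sum_univ_four]
  let B := basisOfTopLeSpanOfCardEqFinrank ![a, b, c, d] hs (by simp [h.1])
  have hB : ∀ x : Fin 4 → K, B.equivFun.symm x = comb a b c d x := by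
    intro x
    rw [Module.Basis.equivFun_symm_apply]
    simp [B, Fin.sum_univ_four, comb]
  have key : ∀ x y : Fin 4 → K, comb a b c d x * comb a b c d y =
      comb a b c d (mul4 i x y) := by
    intro x y
    rw [comb_mul_comb, haa, hab, hac, hbb, hbc, hcc, had, hbd, hcd, hdd]
    fin_cases i <;> simp [mul4, comb] <;> module
  have hE : ∀ x y, B.equivFun (x * y) = mul4 i (B.equivFun x) (B.equivFun y) := by
    intro x y
    refine B.equivFun.symm.injective ?_
    rw [hB (mul4 i _ _), ← key, ← hB, ← hB]
    simp only [LinearEquiv.symm_apply_apply]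
  exact ⟨i, B.equivFun, fun x y => (hE x y).trans (J4_mul i _ _).symm⟩

end Frames

/-! ### All products in a central line: ternary quadratic forms. -/

section Classification

variable {K : Type*} [Field K] {J : Type*} [NonUnitalNonAssocCommRing J] [Module K J]
  [SMulCommClass K J J] [IsScalarTower K J J]

theorem classified_of_form_rank_one {a b c d : J} (h : Frame K a b c d) (hd : ∀ x, x * d = 0)
    (haa : a * a = d) (hbb : b * b = 0) (hcc : c * c = 0)
    (hab : a * b = 0) (hac : a * c = 0) (hbc : b * c = 0) : Classified K J := by
  have hd' : ∀ x, d * x = 0 := fun x => (mul_comm d x).trans (hd x)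
  refine h.swap₂₃.swap₁₂.classified 1 ?_ ?_ ?_ ?_ ?_ ?_ ?_ ?_ ?_ ?_ <;>
    simp [mul4, comb, hd, hd', haa, hbb, hcc, hab, hac, hbc]

theorem classified_of_form_rank_two {a b c d : J} (h : Frame K a b c d) (hd : ∀ x, x * d = 0)
    (haa : a * a = d) (hbb : b * b = d) (hcc : c * c = 0)
    (hab : a * b = 0) (hac : a * c = 0) (hbc : b * c = 0) : Classified K J := by
  have hd' : ∀ x, d * x = 0 := fun x => (mul_comm d x).trans (hd x)
  refine h.swap₂₃.classified 2 ?_ ?_ ?_ ?_ ?_ ?_ ?_ ?_ ?_ ?_ <;>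
    simp [mul4, comb, hd, hd', haa, hbb, hcc, hab, hac, hbc]

theorem classified_of_form_rank_three {a b c d : J} (h : Frame K a b c d)
    (hd : ∀ x, x * d = 0) (haa : a * a = d) (hbb : b * b = d) (hcc : c * c = d)
    (hab : a * b = 0) (hac : a * c = 0) (hbc : b * c = 0) : Classified K J := by
  refine h.classified 4 ?_ ?_ ?_ ?_ ?_ ?_ ?_ ?_ ?_ ?_ <;>
    simp [mul4, comb, hd, haa, hbb, hcc, hab, hac, hbc]

theorem exists_sq_mul_eq [IsAlgClosed K] (x y : K) (hx : x ≠ 0) (hy : y ≠ 0) :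
    ∃ p : K, p ≠ 0 ∧ p * p * x = y := by
  obtain ⟨p, hp⟩ := IsAlgClosed.exists_pow_nat_eq (y / x) two_pos
  refine ⟨p, ?_, ?_⟩
  · rintro rfl
    have : y / x = 0 := by simpa using hp.symm
    simp_all
  · rw [← sq, hp, div_mul_cancel₀ _ hx]

variable [IsAlgClosed K]

theorem exists_sq_mul_eq_zero_or_one (x : K) :
    ∃ p : K, p ≠ 0 ∧ (p * p * x = 0 ∨ p * p * x = 1) := by
  by_cases hx : x = 0
  · exact ⟨1, one_ne_zero, .inl (by simp [hx])⟩
  · obtain ⟨p, hp, h⟩ := exists_sq_mul_eq x 1 hx one_ne_zero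
    exact ⟨p, hp, .inr h⟩

theorem classified_of_form_diagonal {a b c d : J} (h : Frame K a b c d) (hd : ∀ x, x * d = 0)
    {α β γ : K} (haa : a * a = α • d) (hbb : b * b = β • d) (hcc : c * c = γ • d)
    (hab : a * b = 0) (hac : a * c = 0) (hbc : b * c = 0) : Classified K J := by
  obtain ⟨p, hp, hpα⟩ := exists_sq_mul_eq_zero_or_one α
  obtain ⟨q, hq, hqβ⟩ := exists_sq_mul_eq_zero_or_one β
  obtain ⟨r, hr, hrγ⟩ := exists_sq_mul_eq_zero_or_one γ
  have h' := h.smul hp hq hr one_ne_zero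
  rw [one_smul] at h'
  have haa' : (p • a) * (p • a) = (p * p * α) • d := by
    rw [smul_mul_smul_comm, haa, smul_smul]
  have hbb' : (q • b) * (q • b) = (q * q * β) • d := by
    rw [smul_mul_smul_comm, hbb, smul_smul]
  have hcc' : (r • c) * (r • c) = (r * r * γ) • d := by
    rw [smul_mul_smul_comm, hcc, smul_smul]
  have hab' : (p • a) * (q • b) = 0 := by rw [smul_mul_smul_comm, hab, smul_zero]
  have hac' : (p • a) * (r • c) = 0 := by rw [smul_mul_smul_comm, hac, smul_zero]
  have hbc' : (q • b) * (r • c) = 0 := by rw [smul_mul_smul_comm, hbc, smul_zero]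
  have hba' := (mul_comm (q • b) (p • a)).trans hab'
  have hca' := (mul_comm (r • c) (p • a)).trans hac'
  have hcb' := (mul_comm (r • c) (q • b)).trans hbc'
  rcases hpα with e₁ | e₁ <;> rcases hqβ with e₂ | e₂ <;> rcases hrγ with e₃ | e₃ <;>
    rw [e₁] at haa' <;> rw [e₂] at hbb' <;> rw [e₃] at hcc' <;>
    simp only [zero_smul, one_smul] at haa' hbb' hcc'
  · have hd' : ∀ x, d * x = 0 := fun x => (mul_comm d x).trans (hd x)
    refine h'.classified 0 ?_ ?_ ?_ ?_ ?_ ?_ ?_ ?_ ?_ ?_ <;>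
      simp only [mul4, comb, hd, haa', hbb', hcc', hab', hac', hbc'] <;> simp
  · exact classified_of_form_rank_one h'.swap₁₂.swap₀₁ hd hcc' haa' hbb' hca' hcb' hab'
  · exact classified_of_form_rank_one h'.swap₀₁ hd hbb' haa' hcc' hba' hbc' hac'
  · exact classified_of_form_rank_two h'.swap₀₁.swap₁₂ hd hbb' hcc' haa' hbc' hba' hca'
  · exact classified_of_form_rank_one h' hd haa' hbb' hcc' hab' hac' hbc'
  · exact classified_of_form_rank_two h'.swap₁₂ hd haa' hcc' hbb' hac' hab' hcb'
  · exact classified_of_form_rank_two h' hd haa' hbb' hcc' hab' hac' hbc'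
  · exact classified_of_form_rank_three h' hd haa' hbb' hcc' hab' hac' hbc'

/-- Only the plane of `b, c` remains to be diagonalised: split off a vector with nonzero square, or
pass to `b + c`, `b - c` if both squares vanish. -/
theorem classified_of_form_orthogonal (h2 : (2 : K) ≠ 0) {a b c d : J} (h : Frame K a b c d)
    (hd : ∀ x, x * d = 0) {α β γ θ : K} (haa : a * a = α • d) (hbb : b * b = β • d)
    (hcc : c * c = γ • d) (hab : a * b = 0) (hac : a * c = 0) (hbc : b * c = θ • d) :
    Classified K J := by
  have hcb := (mul_comm c b).trans hbc
  by_cases hβ : β = 0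
  · by_cases hγ : γ = 0
    · have h' : Frame K a (b + c) (b - c) d := h.change ⟨1, 0, 0, 0, by module⟩
        ⟨0, 2⁻¹, 2⁻¹, 0, by match_scalars <;> field_simp <;> norm_num⟩
        ⟨0, 2⁻¹, -2⁻¹, 0, by match_scalars <;> field_simp <;> norm_num⟩ ⟨0, 0, 0, 1, by module⟩
      subst hβ hγ
      refine classified_of_form_diagonal h' hd (α := α) (β := 2 * θ) (γ := -2 * θ)
        haa ?_ ?_ ?_ ?_ ?_ <;>
        simp only [mul_add, add_mul, mul_sub, sub_mul, hab, hac, hbb, hcc, hbc, hcb] <;> module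
    · have h' : Frame K a (b - (θ / γ) • c) c d := h.change ⟨1, 0, 0, 0, by module⟩
        ⟨0, 1, θ / γ, 0, by module⟩ ⟨0, 0, 1, 0, by module⟩ ⟨0, 0, 0, 1, by module⟩
      refine classified_of_form_diagonal h' hd (α := α) (β := -θ ^ 2 / γ) (γ := γ)
        haa ?_ hcc ?_ hac ?_ <;>
        simp only [mul_sub, sub_mul, hab, hac, hbb, hcc, hbc, hcb, hβ, smul_mul_assoc,
          mul_smul_comm] <;> match_scalars <;> field_simp <;> ring
  · have h' : Frame K a b (c - (θ / β) • b) d := h.change ⟨1, 0, 0, 0, by module⟩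
      ⟨0, 1, 0, 0, by module⟩ ⟨0, θ / β, 1, 0, by module⟩ ⟨0, 0, 0, 1, by module⟩
    refine classified_of_form_diagonal h' hd (α := α) (β := β) (γ := γ - θ ^ 2 / β)
      haa hbb ?_ hab ?_ ?_ <;>
      simp only [mul_sub, sub_mul, hab, hac, hbb, hcc, hbc, hcb, smul_mul_assoc,
        mul_smul_comm] <;> match_scalars <;> field_simp <;> ring

theorem classified_of_form_anisotropic (h2 : (2 : K) ≠ 0) {a b c d : J} (h : Frame K a b c d)
    (hd : ∀ x, x * d = 0) {α β γ δ ε θ : K} (haa : a * a = α • d) (hbb : b * b = β • d)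
    (hcc : c * c = γ • d) (hab : a * b = δ • d) (hac : a * c = ε • d) (hbc : b * c = θ • d)
    (hα : α ≠ 0) : Classified K J := by
  have hba := (mul_comm b a).trans hab
  have hca := (mul_comm c a).trans hac
  have hcb := (mul_comm c b).trans hbc
  have h' : Frame K a (b - (δ / α) • a) (c - (ε / α) • a) d :=
    h.change ⟨1, 0, 0, 0, by module⟩ ⟨δ / α, 1, 0, 0, by module⟩ ⟨ε / α, 0, 1, 0, by module⟩
      ⟨0, 0, 0, 1, by module⟩
  refine classified_of_form_orthogonal h2 h' hd (α := α) (β := β - δ ^ 2 / α)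
    (γ := γ - ε ^ 2 / α) (θ := θ - δ * ε / α) haa ?_ ?_ ?_ ?_ ?_ <;>
    simp only [mul_sub, sub_mul, haa, hab, hba, hca, hac, hbb, hcc, hbc, smul_mul_assoc,
      mul_smul_comm] <;> match_scalars <;> field_simp <;> ring

theorem classified_of_form (h2 : (2 : K) ≠ 0) {a b c d : J} (h : Frame K a b c d)
    (hd : ∀ x, x * d = 0) {α β γ δ ε θ : K} (haa : a * a = α • d) (hbb : b * b = β • d)
    (hcc : c * c = γ • d) (hab : a * b = δ • d) (hac : a * c = ε • d)
    (hbc : b * c = θ • d) : Classified K J := by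
  have hba := (mul_comm b a).trans hab
  have hca := (mul_comm c a).trans hac
  have hcb := (mul_comm c b).trans hbc
  by_cases hα : α ≠ 0
  · exact classified_of_form_anisotropic h2 h hd haa hbb hcc hab hac hbc hα
  by_cases hβ : β ≠ 0
  · exact classified_of_form_anisotropic h2 h.swap₀₁ hd hbb haa hcc hba hbc hac hβ
  by_cases hγ : γ ≠ 0
  · exact classified_of_form_anisotropic h2 h.swap₁₂.swap₀₁ hd hcc haa hbb hca hcb hab hγ
  push Not at hα hβ hγ
  subst hα hβ hγ
  by_cases hδ : δ ≠ 0
  -- Polarisation: with `a² = b² = 0`, the square of `a + b` is `2δ d`, which is nonzero.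
  · have h' : Frame K (a + b) b c d := h.change ⟨1, -1, 0, 0, by module⟩ ⟨0, 1, 0, 0, by module⟩
      ⟨0, 0, 1, 0, by module⟩ ⟨0, 0, 0, 1, by module⟩
    refine classified_of_form_anisotropic h2 h' hd (α := 2 * δ) (β := 0) (γ := 0) (δ := δ)
      (ε := ε + θ) (θ := θ) ?_ hbb hcc ?_ ?_ hbc (mul_ne_zero h2 hδ) <;>
      simp only [mul_add, add_mul, haa, hab, hba, hbb, hac, hbc] <;> module
  by_cases hε : ε ≠ 0
  · have h' : Frame K (a + c) b c d := h.change ⟨1, 0, -1, 0, by module⟩ ⟨0, 1, 0, 0, by module⟩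
      ⟨0, 0, 1, 0, by module⟩ ⟨0, 0, 0, 1, by module⟩
    refine classified_of_form_anisotropic h2 h' hd (α := 2 * ε) (β := 0) (γ := 0) (δ := δ + θ)
      (ε := ε) (θ := θ) ?_ hbb hcc ?_ ?_ hbc (mul_ne_zero h2 hε) <;>
      simp only [mul_add, add_mul, haa, hab, hca, hcc, hac, hcb] <;> module
  push Not at hδ hε
  subst hδ hε
  rw [zero_smul] at hab hac
  exact classified_of_form_orthogonal h2 h hd haa hbb hcc hab hac hbc

end Classification

/-! ### Binary form of rank one: `a² = c`. -/

section RankOne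

variable {K : Type*} [Field K] {J : Type*} [NonUnitalNonAssocCommRing J] [Module K J]
  [SMulCommClass K J J] [IsScalarTower K J J]

/-- Algebras with `a² = c`, `b ∘ c = μ d`, `μ ≠ 0`, are isomorphic to `J_{4,6}`. -/
theorem classified_of_bc_ne_zero (h2 : (2 : K) ≠ 0) {a b c d : J} (h : Frame K a b c d)
    (hd : ∀ x, x * d = 0) {β γ μ : K} (haa : a * a = c) (hab : a * b = β • d)
    (hbb : b * b = γ • d) (hac : a * c = 0) (hbc : b * c = μ • d) (hcc : c * c = 0)
    (hμ : μ ≠ 0) : Classified K J := by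
  have hca := (mul_comm c a).trans hac
  have hcb := (mul_comm c b).trans hbc
  -- As `b * c` is nonzero, multiples of `c` can be subtracted to make `a * b` and `b²` vanish.
  have h' : Frame K (a - (β / μ) • c) c (b - (γ / (2 * μ)) • c) (μ • d) :=
    h.change ⟨1, β / μ, 0, 0, by module⟩ ⟨0, γ / (2 * μ), 1, 0, by module⟩ ⟨0, 1, 0, 0, by module⟩
      ⟨0, 0, 0, μ⁻¹, by simp [smul_smul, hμ]⟩
  refine h'.classified 5 ?_ ?_ ?_ ?_ ?_ ?_ ?_ ?_ ?_ ?_ <;>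
    simp [smul_mul_assoc, mul_smul_comm, mul4, comb, mul_sub, sub_mul, haa, hab, hbb, hac, hca,
      hbc, hcb, hcc, hd,
      smul_smul] <;>
    match_scalars <;> field_simp <;> ring

theorem classified_of_bc_eq_zero [IsAlgClosed K] {a b c d : J} (h : Frame K a b c d)
    (hd : ∀ x, x * d = 0) {γ l : K} (haa : a * a = c) (hab : a * b = 0)
    (hbb : b * b = γ • d) (hac : a * c = l • d) (hbc : b * c = 0) (hcc : c * c = 0)
    (hl : l ≠ 0) : Classified K J := by
  have hd' : ∀ x, d * x = 0 := fun x => (mul_comm d x).trans (hd x)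
  have hcb := (mul_comm c b).trans hbc
  by_cases hγ : γ = 0
  · have h' := (h.swap₁₂.swap₂₃).smul (p := 1) (q := 1) (r := l) (s := 1) one_ne_zero one_ne_zero
      hl one_ne_zero
    simp only [one_smul] at h'
    refine h'.classified 3 ?_ ?_ ?_ ?_ ?_ ?_ ?_ ?_ ?_ ?_ <;>
      simp [smul_mul_assoc, mul_smul_comm, mul4, comb, haa, hab, hac, hcc, hcb, hbb, hd, hd', hγ]
  · obtain ⟨p, hp, hpγ⟩ := exists_sq_mul_eq γ l hγ hl
    have h' := h.swap₁₂.smul (p := 1) (q := 1) (r := p) (s := l) one_ne_zero one_ne_zero hp hl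
    simp only [one_smul] at h'
    refine h'.classified 6 ?_ ?_ ?_ ?_ ?_ ?_ ?_ ?_ ?_ ?_ <;>
      simp [smul_mul_assoc, mul_smul_comm, mul4, comb, haa, hab, hac, hcc, hcb, hbb, hd,
        smul_smul, ← hpγ, mul_assoc]

theorem classified_of_central_rank_one [IsAlgClosed K] (h2 : (2 : K) ≠ 0) {a b c d : J}
    (h : Frame K a b c d) (hd : ∀ x, x * d = 0) (hc : ∀ x, x * c = 0) {β γ : K}
    (haa : a * a = c) (hab : a * b = β • d) (hbb : b * b = γ • d) : Classified K J := by
  have hc' : ∀ x, c * x = 0 := fun x => (mul_comm c x).trans (hc x)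
  have hba := (mul_comm b a).trans hab
  by_cases hγ : γ = 0
  · by_cases hβ : β = 0
    · refine h.swap₁₂.classified 1 ?_ ?_ ?_ ?_ ?_ ?_ ?_ ?_ ?_ ?_ <;>
        simp [mul4, comb, haa, hab, hbb, hc, hd, hc', hβ, hγ]
    · have h' := h.smul (p := 1) (q := 1) (r := 1) (s := β) one_ne_zero one_ne_zero one_ne_zero hβ
      simp only [one_smul] at h'
      refine h'.classified 11 ?_ ?_ ?_ ?_ ?_ ?_ ?_ ?_ ?_ ?_ <;>
        simp [mul_smul_comm, mul4, comb, haa, hab, hbb, hc, hd, hγ]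
  -- The vectors `a - (β/γ) b` and `b` are orthogonal with independent squares `c - (β²/γ) d` and `γ
  -- d`; their sum and difference have equal squares and an independent product.
  · have h' : Frame K (a - (β / γ) • b + b) (a - (β / γ) • b - b)
        (c - (β ^ 2 / γ) • d + γ • d) (c - (β ^ 2 / γ) • d - γ • d) :=
      h.change ⟨2⁻¹ + β / γ * 2⁻¹, 2⁻¹ - β / γ * 2⁻¹, 0, 0, by
          match_scalars <;> field_simp <;> ring⟩
        ⟨2⁻¹, -2⁻¹, 0, 0, by match_scalars <;> field_simp <;> ring⟩
        ⟨0, 0, 2⁻¹ + β ^ 2 / γ ^ 2 * 2⁻¹, 2⁻¹ - β ^ 2 / γ ^ 2 * 2⁻¹, by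
          match_scalars <;> field_simp <;> ring⟩
        ⟨0, 0, γ⁻¹ * 2⁻¹, -γ⁻¹ * 2⁻¹, by match_scalars <;> field_simp <;> ring⟩
    refine h'.classified 12 ?_ ?_ ?_ ?_ ?_ ?_ ?_ ?_ ?_ ?_ <;>
      simp [smul_mul_assoc, mul_smul_comm, mul4, comb, mul_sub, sub_mul, mul_add, add_mul, haa,
        hab, hba, hbb, hc, hd,
        smul_smul] <;>
      match_scalars <;> field_simp <;> ring

theorem classified_of_rank_one [IsAlgClosed K] [IsCommJordan J] (h2 : (2 : K) ≠ 0)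
    {a b c d : J} (h : Frame K a b c d) (hd : ∀ x, x * d = 0) {β γ l μ : K} (haa : a * a = c)
    (hab : a * b = β • d) (hbb : b * b = γ • d) (hac : a * c = l • d) (hbc : b * c = μ • d) :
    Classified K J := by
  have hd' : ∀ x, d * x = 0 := fun x => (mul_comm d x).trans (hd x)
  have hba := (mul_comm b a).trans hab
  have hcb := (mul_comm c b).trans hbc
  have hcc : c * c = 0 := by
    have := IsCommJordan.lmul_comm_rmul_rmul a a
    rwa [haa, hac, mul_smul_comm, hd, smul_zero] at this
  by_cases hμ : μ = 0
  · rw [hμ, zero_smul] at hbc hcb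
    by_cases hl : l = 0
    · rw [hl, zero_smul] at hac
      refine classified_of_central_rank_one h2 h hd (fun x => ?_) haa hab hbb
      obtain ⟨r, s, t, u, rfl⟩ := h.2 x
      simp [smul_mul_assoc, add_mul, hac, hbc, hcc, hd']
    · have h' : Frame K a (b - (β / l) • c) c d := h.change ⟨1, 0, 0, 0, by module⟩
        ⟨0, 1, β / l, 0, by module⟩ ⟨0, 0, 1, 0, by module⟩ ⟨0, 0, 0, 1, by module⟩
      refine classified_of_bc_eq_zero h' hd (γ := γ) (l := l) haa ?_ ?_ hac ?_ hcc hl <;>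
        simp [smul_mul_assoc, mul_smul_comm, mul_sub, sub_mul, hab, hbb, hac, hbc, hcb, hcc,
          smul_smul, hl]
  · have h' : Frame K (a - (l / μ) • b) b
        (c + (γ * (l / μ) ^ 2 - 2 * β * (l / μ)) • d) d :=
      h.change ⟨1, l / μ, 0, 0, by module⟩ ⟨0, 1, 0, 0, by module⟩
        ⟨0, 0, 1, -(γ * (l / μ) ^ 2 - 2 * β * (l / μ)), by module⟩ ⟨0, 0, 0, 1, by module⟩
    refine classified_of_bc_ne_zero h2 h' hd (β := β - l / μ * γ) (γ := γ) (μ := μ)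
      ?_ ?_ hbb ?_ ?_ ?_ hμ <;>
      simp [smul_mul_assoc, mul_smul_comm, mul_sub, sub_mul, mul_add, add_mul, haa, hab, hba,
        hbb, hac, hbc, hcc, hd, hd',
        smul_smul, hμ]
    all_goals module

end RankOne

/-! ### Binary form of rank two: `a * b = c`. -/

section RankTwo

variable {K : Type*} [Field K] {J : Type*} [NonUnitalNonAssocCommRing J] [Module K J]
  [SMulCommClass K J J] [IsScalarTower K J J]

/-- Here the kernel of multiplication by `c` on the plane of `a, b` is the line of `a`, which is
isotropic modulo `d`. This leads to `J_{4,9}` or `J_{4,10}` according to whether `a²` vanishes. -/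
theorem classified_of_hyperbolic_isotropic (h2 : (2 : K) ≠ 0) {a b c d : J}
    (h : Frame K a b c d) (hd : ∀ x, x * d = 0) {α γ μ : K} (haa : a * a = α • d)
    (hab : a * b = c) (hbb : b * b = γ • d) (hac : a * c = 0) (hbc : b * c = μ • d)
    (hcc : c * c = 0) (hμ : μ ≠ 0) : Classified K J := by
  -- Chosen so that `B² = -a²`; then `(B + a)² = 2c`, `(B - a)² = -2c` and `(B + a)(B - a) = -2α d`.
  obtain ⟨B, hB⟩ : ∃ B, B = b - ((γ + α) / (2 * μ)) • c := ⟨_, rfl⟩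
  have hcb := (mul_comm c b).trans hbc
  have hBB : B * B = -α • d := by
    rw [hB]
    simp only [mul_sub, sub_mul, smul_mul_assoc, mul_smul_comm, hbb, hbc, hcb, hcc]
    match_scalars
    field_simp
    ring
  have hBc : B * c = μ • d := by
    simp [hB, sub_mul, smul_mul_assoc, hbc, hcc]
  have haB : a * B = c := by
    simp [hB, mul_sub, mul_smul_comm, hab, hac]
  have hBa := (mul_comm B a).trans haB
  have h' : Frame K a B c d := h.change ⟨1, 0, 0, 0, by module⟩
    ⟨0, 1, (γ + α) / (2 * μ), 0, by rw [hB]; module⟩ ⟨0, 0, 1, 0, by module⟩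
    ⟨0, 0, 0, 1, by module⟩
  clear hB hab hbb hbc hcb
  by_cases hα : α = 0
  · have h'' : Frame K (B + a) (B - a) ((2 : K) • c) ((2 * μ) • d) := h'.change
      ⟨2⁻¹, -2⁻¹, 0, 0, by match_scalars <;> field_simp <;> ring⟩
      ⟨2⁻¹, 2⁻¹, 0, 0, by match_scalars <;> field_simp <;> ring⟩
      ⟨0, 0, 2⁻¹, 0, by match_scalars <;> field_simp <;> ring⟩
      ⟨0, 0, 0, (2 * μ)⁻¹, by match_scalars <;> field_simp <;> ring⟩
    refine h''.classified 8 ?_ ?_ ?_ ?_ ?_ ?_ ?_ ?_ ?_ ?_ <;>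
      simp only [mul_sub, sub_mul, mul_add, add_mul, smul_mul_assoc, mul_smul_comm, haa, haB, hBa,
        hBB, hac, hBc, hcc, hd, hα] <;> simp [mul4, comb] <;> module
  -- Scaling both vectors by `p` turns their product into `-2αp² d` and their products with `2p² c`
  -- into `2μp³ d`; these agree for `p = -α/μ`.
  · have h'' : Frame K ((-α / μ) • (B + a)) ((-α / μ) • (B - a))
        ((2 * (α / μ) ^ 2) • c) ((-2 * α * (α / μ) ^ 2) • d) := h'.change
      ⟨-(μ / α) * 2⁻¹, (μ / α) * 2⁻¹, 0, 0, by match_scalars <;> field_simp <;> ring⟩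
      ⟨-(μ / α) * 2⁻¹, -(μ / α) * 2⁻¹, 0, 0, by match_scalars <;> field_simp <;> ring⟩
      ⟨0, 0, (2 * (α / μ) ^ 2)⁻¹, 0, by match_scalars <;> field_simp <;> ring⟩
      ⟨0, 0, 0, (-2 * α * (α / μ) ^ 2)⁻¹, by match_scalars <;> field_simp <;> ring⟩
    refine h''.classified 9 ?_ ?_ ?_ ?_ ?_ ?_ ?_ ?_ ?_ ?_ <;>
      simp only [mul_sub, sub_mul, mul_add, add_mul, smul_mul_assoc, mul_smul_comm, haa, haB, hBa,
        hBB, hac, hBc, hcc, hd, smul_add, smul_sub] <;> simp [mul4, comb] <;>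
      match_scalars <;> field_simp <;> ring

/-- Now `a - b` spans the kernel of multiplication by `c`, and its square is nonzero modulo `d`. The
factor `i` with `i² = -1` gives `a + b` and `i (a - b)` the same square `2c` modulo `d`, and
corrections by `c` make them orthogonal with equal squares. -/
theorem classified_of_hyperbolic_anisotropic [IsAlgClosed K] (h2 : (2 : K) ≠ 0) {a b c d : J}
    (h : Frame K a b c d) (hd : ∀ x, x * d = 0) {α γ : K} (haa : a * a = α • d)
    (hab : a * b = c) (hbb : b * b = γ • d) (hac : a * c = d) (hbc : b * c = d)
    (hcc : c * c = 0) : Classified K J := by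
  have hd' : ∀ x, d * x = 0 := fun x => (mul_comm d x).trans (hd x)
  have hba := (mul_comm b a).trans hab
  have hca := (mul_comm c a).trans hac
  have hcb := (mul_comm c b).trans hbc
  have h4 : (4 : K) ≠ 0 := by
    rw [show (4 : K) = 2 * 2 by norm_num]
    exact mul_ne_zero h2 h2
  obtain ⟨i, hi⟩ := IsAlgClosed.exists_pow_nat_eq (-1 : K) two_pos
  have hi0 : i ≠ 0 := by
    rintro rfl
    simp at hi
  have h' : Frame K (a + b - ((α + γ) / 2) • c) (i • (a - b) - (i * (α - γ) / 2) • c)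
      ((2 : K) • c - (α + γ) • d) ((4 : K) • d) := by
    have h1 : Frame K (a + b) (i • (a - b)) c d := h.change
      ⟨2⁻¹, i⁻¹ * 2⁻¹, 0, 0, by match_scalars <;> field_simp <;> ring⟩
      ⟨2⁻¹, -i⁻¹ * 2⁻¹, 0, 0, by match_scalars <;> field_simp <;> ring⟩
      ⟨0, 0, 1, 0, by module⟩ ⟨0, 0, 0, 1, by module⟩
    have h3 : Frame K (a + b - ((α + γ) / 2) • c) (i • (a - b) - (i * (α - γ) / 2) • c) c d :=
      h1.change ⟨1, 0, (α + γ) / 2, 0, by module⟩ ⟨0, 1, i * (α - γ) / 2, 0, by module⟩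
        ⟨0, 0, 1, 0, by module⟩ ⟨0, 0, 0, 1, by module⟩
    exact h3.change ⟨1, 0, 0, 0, by module⟩ ⟨0, 1, 0, 0, by module⟩
      ⟨0, 0, 2⁻¹, (α + γ) * 2⁻¹ * 4⁻¹, by match_scalars <;> field_simp <;> ring⟩
      ⟨0, 0, 0, 4⁻¹, by match_scalars <;> field_simp <;> ring⟩
  refine h'.classified 7 ?_ ?_ ?_ ?_ ?_ ?_ ?_ ?_ ?_ ?_ <;>
    simp only [mul_sub, sub_mul, mul_add, add_mul, smul_mul_assoc, mul_smul_comm, haa, hab, hba,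
      hbb, hac, hca, hcb, hbc, hcc, hd, hd', smul_add, smul_sub] <;> simp [mul4, comb]
  all_goals match_scalars <;> field_simp <;>
    first | ring1 | linear_combination (α + γ) * hi | linear_combination -2 * hi

theorem classified_of_hyperbolic_central [IsAlgClosed K] (h2 : (2 : K) ≠ 0) {a b c d : J}
    (h : Frame K a b c d) (hd : ∀ x, x * d = 0) (hc : ∀ x, x * c = 0) {α γ : K}
    (haa : a * a = α • d) (hab : a * b = c) (hbb : b * b = γ • d) : Classified K J := by
  have hba := (mul_comm b a).trans hab
  by_cases hα : α = 0
  · by_cases hγ : γ = 0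
    · refine classified_of_form h2 h.swap₂₃ hc (α := 0) (β := 0) (γ := 0) (δ := 1) (ε := 0)
        (θ := 0) ?_ ?_ ?_ ?_ ?_ ?_ <;> simp [haa, hab, hbb, hd, hα, hγ]
    · exact classified_of_central_rank_one h2
        (h.swap₀₁.swap₂₃.smul one_ne_zero one_ne_zero hγ one_ne_zero) (by simpa using hc)
        (fun x => by rw [mul_smul_comm, hd, smul_zero]) (β := 1) (γ := 0)
        (by simpa using hbb) (by simpa using hba) (by simp [haa, hα])
  · by_cases hγ : γ = 0
    · exact classified_of_central_rank_one h2
        (h.swap₂₃.smul one_ne_zero one_ne_zero hα one_ne_zero) (by simpa using hc)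
        (fun x => by rw [mul_smul_comm, hd, smul_zero]) (β := 1) (γ := 0)
        (by simpa using haa) (by simpa using hab) (by simp [hbb, hγ])
    · obtain ⟨p, hp, hpγ⟩ := exists_sq_mul_eq γ α hγ hα
      have h' := h.swap₂₃.smul (p := 1) one_ne_zero hp hα hp
      rw [one_smul] at h'
      refine h'.classified 12 ?_ ?_ ?_ ?_ ?_ ?_ ?_ ?_ ?_ ?_ <;>
        simp [smul_mul_assoc, mul_smul_comm, mul4, comb, haa, hab, hbb, hc, hd, smul_smul,
          ← hpγ, mul_assoc]

theorem classified_of_hyperbolic [IsAlgClosed K] [IsCommJordan J] (h2 : (2 : K) ≠ 0)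
    {a b c d : J} (h : Frame K a b c d) (hd : ∀ x, x * d = 0) {α γ l μ : K}
    (haa : a * a = α • d) (hab : a * b = c) (hbb : b * b = γ • d) (hac : a * c = l • d)
    (hbc : b * c = μ • d) : Classified K J := by
  have hd' : ∀ x, d * x = 0 := fun x => (mul_comm d x).trans (hd x)
  have hba := (mul_comm b a).trans hab
  have hcc : c * c = 0 := by
    -- With `x = a + b` the identity reads `x² * x² = x * (x * x²)`: the left side is `4c²`, and the
    -- right side vanishes since `x * x²` is a multiple of `d`.
    have hj := IsCommJordan.lmul_comm_rmul_rmul (a + b) (a + b)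
    have hsq : (a + b) * (a + b) = (2 : K) • c + (α + γ) • d := by
      simp only [mul_add, add_mul, haa, hab, hba, hbb]
      module
    have hcube : (a + b) * ((2 : K) • c + (α + γ) • d) = (2 * (l + μ)) • d := by
      simp only [mul_add, add_mul, mul_smul_comm, hac, hbc, hd]
      module
    rw [hsq, hcube, mul_smul_comm, hd, smul_zero] at hj
    simp only [mul_add, add_mul, smul_mul_assoc, mul_smul_comm, hd, hd', smul_zero, add_zero,
      smul_smul] at hj
    exact (smul_eq_zero.1 hj).resolve_left (mul_ne_zero h2 h2)
  by_cases hl : l = 0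
  · rw [hl, zero_smul] at hac
    by_cases hμ : μ = 0
    · rw [hμ, zero_smul] at hbc
      refine classified_of_hyperbolic_central h2 h hd (fun x => ?_) haa hab hbb
      obtain ⟨r, s, t, u, rfl⟩ := h.2 x
      simp [smul_mul_assoc, add_mul, hac, hbc, hcc, hd']
    · exact classified_of_hyperbolic_isotropic h2 h hd haa hab hbb hac hbc hcc hμ
  · by_cases hμ : μ = 0
    · rw [hμ, zero_smul] at hbc
      exact classified_of_hyperbolic_isotropic h2 h.swap₀₁ hd hbb hba haa hbc hac hcc hl
    · have h' := h.smul hμ hl (mul_ne_zero hl hμ)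
          (mul_ne_zero (mul_ne_zero hl hμ) (mul_ne_zero hl hμ))
      refine classified_of_hyperbolic_anisotropic h2 h' (fun x => ?_) (α := α / l ^ 2)
        (γ := γ / μ ^ 2) ?_ ?_ ?_ ?_ ?_ ?_ <;>
        simp only [smul_mul_assoc, mul_smul_comm, haa, hab, hbb, hac, hbc, hcc, hd, smul_smul,
          smul_zero] <;>
        match_scalars <;> field_simp

end RankTwo

/-! ### Reduction of a triangular basis to the cases above. -/

section GeneralFrames

variable {K : Type*} [Field K] {J : Type*} [NonUnitalNonAssocCommRing J] [Module K J]
  [SMulCommClass K J J] [IsScalarTower K J J] [IsCommJordan J]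

/-- The algebras generated by one element, up to a central summand. -/
theorem classified_of_powers (h2 : (2 : K) ≠ 0) {a b c d : J} (h : Frame K a b c d)
    (hd : ∀ x, x * d = 0) {r : K} (haa : a * a = b) (hab : a * b = c)
    (hac : a * c = r • d) : Classified K J := by
  have hd' : ∀ x, d * x = 0 := fun x => (mul_comm d x).trans (hd x)
  have hbb : b * b = r • d := by
    have := IsCommJordan.lmul_comm_rmul_rmul a a
    rwa [haa, hab, hac] at this
  have hcb0 : c * b = 0 := by
    have := IsCommJordan.lmul_comm_rmul_rmul a b
    rwa [haa, hab, hbb, mul_smul_comm, hd, smul_zero] at this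
  have hbc0 := (mul_comm b c).trans hcb0
  have hcc0 : c * c = 0 := by
    -- Evaluating at `a` alone does not reach `c²`; with `a + b` the left side becomes `2c²` and the
    -- right side zero.
    have := IsCommJordan.lmul_comm_rmul_rmul (a + b) b
    simp only [mul_add, add_mul, haa, hab, mul_comm b a, hbb, hcb0, hbc0, hd, hd', mul_smul_comm,
      smul_mul_assoc, smul_zero, add_zero, zero_add, ← two_smul K (c * c)] at this
    exact (smul_eq_zero.1 this).resolve_left h2
  by_cases hr : r = 0
  · refine h.classified 3 ?_ ?_ ?_ ?_ ?_ ?_ ?_ ?_ ?_ ?_ <;>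
      simp [mul4, comb, haa, hab, hac, hbb, hbc0, hcc0, hd, hr]
  · have h' := h.smul (p := 1) (q := 1) (r := 1) one_ne_zero one_ne_zero one_ne_zero hr
    simp only [one_smul] at h'
    refine h'.classified 10 ?_ ?_ ?_ ?_ ?_ ?_ ?_ ?_ ?_ ?_ <;>
      simp [mul4, comb, mul_smul_comm, haa, hab, hac, hbb, hbc0, hcc0, hd]

variable [IsAlgClosed K]

theorem classified_of_two_step_diagonal (h2 : (2 : K) ≠ 0) {a b c d : J} (h : Frame K a b c d)
    (hd : ∀ x, x * d = 0) {α α' β' γ γ' r s t : K} (haa : a * a = α • c + α' • d)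
    (hab : a * b = β' • d) (hbb : b * b = γ • c + γ' • d) (hac : a * c = r • d)
    (hbc : b * c = s • d) (hcc : c * c = t • d) : Classified K J := by
  have hba := (mul_comm b a).trans hab
  have frame : ∀ x y : K, x ≠ 0 → Frame K a b (x • c + y • d) d := fun x y hx =>
    h.change ⟨1, 0, 0, 0, by module⟩ ⟨0, 1, 0, 0, by module⟩
      ⟨0, 0, x⁻¹, -x⁻¹ * y, by match_scalars <;> field_simp <;> ring⟩ ⟨0, 0, 0, 1, by module⟩
  by_cases hα : α = 0
  · by_cases hγ : γ = 0
    · rw [hα, zero_smul, zero_add] at haa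
      rw [hγ, zero_smul, zero_add] at hbb
      exact classified_of_form h2 h hd haa hbb hcc hab hac hbc
    · rw [hα, zero_smul, zero_add] at haa
      refine classified_of_rank_one h2 (frame γ γ' hγ).swap₀₁ hd (l := γ * s) (μ := γ * r)
        hbb hba haa ?_ ?_ <;>
        simp [mul_add, mul_smul_comm, hac, hbc, hd, smul_smul]
  · by_cases hγ : γ = 0
    · rw [hγ, zero_smul, zero_add] at hbb
      refine classified_of_rank_one h2 (frame α α' hα) hd (l := α * r) (μ := α * s)
        haa hab hbb ?_ ?_ <;>
        simp [mul_add, mul_smul_comm, hac, hbc, hd, smul_smul]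
    -- With `k²α = -γ`, the vectors `b + k a` and `b - k a` are isotropic modulo `d`, so their
    -- product can serve as the new `c`.
    · obtain ⟨k, hk0, hk⟩ := exists_sq_mul_eq α (-γ) hα (neg_ne_zero.2 hγ)
      have h' : Frame K (b + k • a) (b - k • a)
          ((2 * γ) • c + (γ' - k * k * α') • d) d := (frame (2 * γ) (γ' - k * k * α')
            (mul_ne_zero h2 hγ)).change
          ⟨2⁻¹ * k⁻¹, -2⁻¹ * k⁻¹, 0, 0, by match_scalars <;> field_simp <;> ring⟩
          ⟨2⁻¹, 2⁻¹, 0, 0, by match_scalars <;> field_simp <;> ring⟩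
          ⟨0, 0, 1, 0, by module⟩ ⟨0, 0, 0, 1, by module⟩
      refine classified_of_hyperbolic h2 h' hd (α := γ' + k * k * α' + 2 * k * β')
        (γ := γ' + k * k * α' - 2 * k * β') (l := 2 * γ * (s + k * r))
        (μ := 2 * γ * (s - k * r)) ?_ ?_ ?_ ?_ ?_ <;>
        simp only [mul_add, add_mul, mul_sub, sub_mul, smul_mul_assoc, mul_smul_comm, haa, hab, hba,
          hbb, hac, hbc, hd] <;>
        match_scalars <;> first | ring1 | linear_combination hk | linear_combination -hk

theorem classified_of_two_step (h2 : (2 : K) ≠ 0) {a b c d : J} (h : Frame K a b c d)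
    (hd : ∀ x, x * d = 0) {α α' β β' γ γ' r s t : K} (haa : a * a = α • c + α' • d)
    (hab : a * b = β • c + β' • d) (hbb : b * b = γ • c + γ' • d) (hac : a * c = r • d)
    (hbc : b * c = s • d) (hcc : c * c = t • d) : Classified K J := by
  have hba := (mul_comm b a).trans hab
  by_cases hα : α = 0
  · by_cases hγ : γ = 0
    · rw [hα, zero_smul, zero_add] at haa
      rw [hγ, zero_smul, zero_add] at hbb
      by_cases hβ : β = 0
      · rw [hβ, zero_smul, zero_add] at hab
        exact classified_of_form h2 h hd haa hbb hcc hab hac hbc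
      · have h' : Frame K a b (β • c + β' • d) d :=
          h.change ⟨1, 0, 0, 0, by module⟩ ⟨0, 1, 0, 0, by module⟩
            ⟨0, 0, β⁻¹, -β⁻¹ * β', by match_scalars <;> field_simp <;> ring⟩
            ⟨0, 0, 0, 1, by module⟩
        refine classified_of_hyperbolic h2 h' hd (l := β * r) (μ := β * s) haa hab hbb ?_ ?_ <;>
          simp [mul_add, mul_smul_comm, hac, hbc, hd, smul_smul]
    · have h' : Frame K (a - (β / γ) • b) b c d := h.change ⟨1, β / γ, 0, 0, by module⟩
        ⟨0, 1, 0, 0, by module⟩ ⟨0, 0, 1, 0, by module⟩ ⟨0, 0, 0, 1, by module⟩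
      refine classified_of_two_step_diagonal h2 h' hd (α := -β ^ 2 / γ)
        (α' := α' - 2 * (β / γ) * β' + (β / γ) ^ 2 * γ') (β' := β' - β / γ * γ')
        (r := r - β / γ * s) ?_ ?_ hbb ?_ hbc hcc <;>
        simp only [sub_mul, mul_sub, smul_mul_assoc, mul_smul_comm, haa, hab, hba, hbb, hac, hbc,
          hα] <;>
        match_scalars <;> field_simp <;> ring
  · have h' : Frame K a (b - (β / α) • a) c d := h.change ⟨1, 0, 0, 0, by module⟩
      ⟨β / α, 1, 0, 0, by module⟩ ⟨0, 0, 1, 0, by module⟩ ⟨0, 0, 0, 1, by module⟩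
    refine classified_of_two_step_diagonal h2 h' hd (γ := γ - β ^ 2 / α)
      (γ' := γ' - 2 * (β / α) * β' + (β / α) ^ 2 * α') (β' := β' - β / α * α')
      (s := s - β / α * r) haa ?_ ?_ hac ?_ hcc <;>
      simp only [sub_mul, mul_sub, smul_mul_assoc, mul_smul_comm, haa, hab, hba, hbb, hac, hbc] <;>
      match_scalars <;> field_simp <;> ring

theorem classified_of_triangular (h2 : (2 : K) ≠ 0) {a b c d : J} (h : Frame K a b c d)
    (hd : ∀ x, x * d = 0) {a1 a2 a3 p2 p3 q2 q3 r s t : K}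
    (haa : a * a = a1 • b + a2 • c + a3 • d) (hab : a * b = p2 • c + p3 • d)
    (hbb : b * b = q2 • c + q3 • d) (hac : a * c = r • d) (hbc : b * c = s • d)
    (hcc : c * c = t • d) : Classified K J := by
  by_cases ha1 : a1 = 0
  · rw [ha1, zero_smul, zero_add] at haa
    exact classified_of_two_step h2 h hd haa hab hbb hac hbc hcc
  obtain ⟨B, hB⟩ : ∃ B, B = a * a := ⟨_, rfl⟩
  have h' : Frame K a B c d := by
    rw [hB, haa]
    exact h.change ⟨1, 0, 0, 0, by module⟩
      ⟨0, a1⁻¹, -a1⁻¹ * a2, -a1⁻¹ * a3, by match_scalars <;> field_simp <;> ring⟩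
      ⟨0, 0, 1, 0, by module⟩ ⟨0, 0, 0, 1, by module⟩
  have haB : a * B = (a1 * p2) • c + (a1 * p3 + a2 * r) • d := by
    rw [hB, haa]
    simp only [mul_add, mul_smul_comm, hab, hac, hd]
    module
  have hBc : B * c = (a1 * s + a2 * t) • d := by
    rw [hB, haa, mul_comm _ c]
    simp only [mul_add, mul_smul_comm, mul_comm c b, hbc, hcc, hd]
    module
  have hcB := (mul_comm c B).trans hBc
  -- If `a³` is a multiple of `d`, then `c` acts as the second generator beside `a`, and `a²` takes
  -- the place of `c` in the rank one case.
  by_cases hp : p2 = 0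
  · rw [hp, mul_zero, zero_smul, zero_add] at haB
    exact classified_of_rank_one h2 h'.swap₁₂ hd hB.symm hac hcc haB hcB
  · have hp' := mul_ne_zero ha1 hp
    obtain ⟨C, hC⟩ : ∃ C, C = a * B := ⟨_, rfl⟩
    have h'' : Frame K a B C d := by
      rw [hC, haB]
      exact h'.change ⟨1, 0, 0, 0, by module⟩ ⟨0, 1, 0, 0, by module⟩
        ⟨0, 0, (a1 * p2)⁻¹, -(a1 * p2)⁻¹ * (a1 * p3 + a2 * r), by
          match_scalars <;> field_simp <;> ring⟩ ⟨0, 0, 0, 1, by module⟩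
    refine classified_of_powers h2 h'' hd (r := a1 * p2 * r) hB.symm hC.symm ?_
    rw [hC, haB]
    simp only [mul_add, mul_smul_comm, hac, hd]
    module

end GeneralFrames

/-! ### A flag of ideals from nilpotency. -/

section Flags

variable {K : Type*} [Field K] {J : Type*} [NonUnitalNonAssocCommRing J] [Module K J]

/-- If `I` were spanned by its products with `J`, it would lie in every term of the lower central
series and vanish. A functional that kills these products but not some `e` in `I` cuts out `H`,
which is an ideal because it contains them. -/
theorem exists_hyperplane_ideal [Module.Finite K J] (hJ : Nilpotent K J) {I : Submodule K J}
    (hI : IsIdeal I) {k : ℕ} (hk : Module.finrank K I = k + 1) :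
    ∃ (H : Submodule K J) (e : J), IsIdeal H ∧ Module.finrank K H = k ∧ e ∈ I ∧
      (∀ x ∈ I, ∃ r : K, ∃ h ∈ H, x = r • e + h) ∧ ∀ x ∈ I, ∀ y, x * y ∈ H := by
  let P : Submodule K J := Submodule.span K {z | ∃ x ∈ I, ∃ y : J, z = x * y}
  have hP : ¬ I ≤ P := by
    intro hle
    have key : ∀ m, I ≤ lowerCentral K J m := by
      intro m
      induction m with
      | zero => exact le_top
      | succ m ih =>
        refine hle.trans (Submodule.span_mono ?_)
        rintro _ ⟨x, hx, y, rfl⟩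
        exact ⟨x, ih hx, y, rfl⟩
    obtain ⟨m, hm⟩ := hJ
    have : I = ⊥ := le_bot_iff.1 (hm ▸ key m)
    rw [this, finrank_bot] at hk
    omega
  obtain ⟨e, heI, heP⟩ := SetLike.not_le_iff_exists.1 hP
  obtain ⟨f, hfe, hf⟩ := Submodule.exists_le_ker_of_notMem heP
  have hmul : ∀ x ∈ I, ∀ y, x * y ∈ I ⊓ LinearMap.ker f := fun x hx y =>
    ⟨hI x hx y, hf (Submodule.subset_span ⟨x, hx, y, rfl⟩)⟩
  have hdec : ∀ x ∈ I, ∃ r : K, ∃ h ∈ I ⊓ LinearMap.ker f, x = r • e + h := by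
    intro x hx
    refine ⟨f x / f e, x - (f x / f e) • e, ⟨I.sub_mem hx (I.smul_mem _ heI), ?_⟩, by abel⟩
    simp [hfe]
  refine ⟨I ⊓ LinearMap.ker f, e, fun x hx => hmul x hx.1, ?_, heI, hdec, hmul⟩
  have hsup : (I ⊓ LinearMap.ker f) ⊔ Submodule.span K {e} = I := by
    refine le_antisymm (sup_le inf_le_left ((Submodule.span_singleton_le_iff_mem _ _).2 heI)) ?_
    intro x hx
    obtain ⟨r, h, hh, rfl⟩ := hdec x hx
    exact Submodule.add_mem _
      (Submodule.mem_sup_right (Submodule.smul_mem _ _ (Submodule.mem_span_singleton_self e)))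
      (Submodule.mem_sup_left hh)
  have := Submodule.finrank_sup_span_singleton (K := K) (p := I ⊓ LinearMap.ker f) (v := e)
    (fun h => hfe h.2)
  rw [hsup, hk] at this
  omega

theorem exists_triangular_frame (hJ : Nilpotent K J) (hfin : Module.finrank K J = 4) :
    ∃ a b c d : J, Frame K a b c d ∧ (∀ x, x * d = 0) ∧
      (∃ r s t : K, a * a = r • b + s • c + t • d) ∧ (∃ r s : K, a * b = r • c + s • d) ∧
      (∃ r s : K, b * b = r • c + s • d) ∧ (∃ r : K, a * c = r • d) ∧
      (∃ r : K, b * c = r • d) ∧ ∃ r : K, c * c = r • d := by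
  have : Module.Finite K J := Module.finite_of_finrank_pos (by omega)
  obtain ⟨H₁, a, hH₁, hk₁, ha, hd₁, hm₁⟩ := exists_hyperplane_ideal hJ (I := ⊤) (k := 3)
    (fun _ _ _ => Submodule.mem_top) (by rw [finrank_top, hfin])
  obtain ⟨H₂, b, hH₂, hk₂, hb, hd₂, hm₂⟩ := exists_hyperplane_ideal hJ hH₁ hk₁
  obtain ⟨H₃, c, hH₃, hk₃, hc, hd₃, hm₃⟩ := exists_hyperplane_ideal hJ hH₂ hk₂
  obtain ⟨H₄, d, hH₄, hk₄, hd, hd₄, hm₄⟩ := exists_hyperplane_ideal hJ hH₃ hk₃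
  have h0 : H₄ = ⊥ := Submodule.finrank_eq_zero.1 hk₄
  have e₃ : ∀ x ∈ H₃, ∃ r : K, x = r • d := by
    intro x hx
    obtain ⟨r, h, hh, rfl⟩ := hd₄ x hx
    rw [h0, Submodule.mem_bot] at hh
    exact ⟨r, by rw [hh, add_zero]⟩
  have e₂ : ∀ x ∈ H₂, ∃ r s : K, x = r • c + s • d := by
    intro x hx
    obtain ⟨r, h, hh, rfl⟩ := hd₃ x hx
    obtain ⟨s, rfl⟩ := e₃ h hh
    exact ⟨r, s, rfl⟩
  have e₁ : ∀ x ∈ H₁, ∃ r s t : K, x = r • b + s • c + t • d := by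
    intro x hx
    obtain ⟨r, h, hh, rfl⟩ := hd₂ x hx
    obtain ⟨s, t, rfl⟩ := e₂ h hh
    exact ⟨r, s, t, (add_assoc _ _ _).symm⟩
  refine ⟨a, b, c, d, ⟨hfin, fun x => ?_⟩, fun x => ?_, e₁ _ (hm₁ a ha a), ?_, e₂ _ (hm₂ b hb b),
    ?_, ?_, e₃ _ (hm₃ c hc c)⟩
  · obtain ⟨r, h, hh, rfl⟩ := hd₁ x Submodule.mem_top
    obtain ⟨s, t, u, rfl⟩ := e₁ h hh
    exact ⟨r, s, t, u, by abel⟩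
  · have := hm₄ d hd x
    rw [h0, Submodule.mem_bot] at this
    rwa [mul_comm]
  · rw [mul_comm]
    exact e₂ _ (hm₂ b hb a)
  · rw [mul_comm]
    exact e₃ _ (hm₃ c hc a)
  · rw [mul_comm]
    exact e₃ _ (hm₃ c hc b)

theorem classified_of_nilpotent [SMulCommClass K J J] [IsScalarTower K J J] [IsAlgClosed K]
    [IsCommJordan J] (h2 : (2 : K) ≠ 0) (hfin : Module.finrank K J = 4) (hJ : Nilpotent K J) :
    Classified K J := by
  obtain ⟨a, b, c, d, h, hd, ⟨a1, a2, a3, haa⟩, ⟨p2, p3, hab⟩, ⟨q2, q3, hbb⟩, ⟨r, hac⟩, ⟨s, hbc⟩,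
    ⟨t, hcc⟩⟩ := exists_triangular_frame hJ hfin
  exact classified_of_triangular h2 h hd haa hab hbb hac hbc hcc

end Flags

end NilpotentJordan

open NilpotentJordan in
theorem mainTheorem1 (K : Type*) [Field K] [IsAlgClosed K] (hK : ringChar K ≠ 2) :
    -- each of the thirteen algebras is a nilpotent Jordan algebra of dimension 4
    (∀ i : Fin 13, Module.finrank K (J4 K i) = 4 ∧ IsCommJordan (J4 K i) ∧
      Nilpotent K (J4 K i)) ∧
    -- they are pairwise non-isomorphic
    (∀ i j : Fin 13, i ≠ j → ¬ Isomorphic K (J4 K i) (J4 K j)) ∧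
    -- every nilpotent Jordan algebra of dimension 4 is isomorphic to one of them
    (∀ (J : Type*) [NonUnitalNonAssocCommRing J] [Module K J] [SMulCommClass K J J]
      [IsScalarTower K J J] [IsCommJordan J],
      Module.finrank K J = 4 → Nilpotent K J → ∃ i : Fin 13, Isomorphic K J (J4 K i)) ∧
    -- the first four are the direct sums of a three-dimensional algebra with `J_{1,1}`
    (∀ i : Fin 4, Isomorphic K (J4 K (Fin.castLE (by norm_num) i)) (J3 K i × J1 K)) ∧
    -- exactly the first four have a central component
    (∀ i : Fin 13, HasCentralComponent K (J4 K i) ↔ i.val < 4) := by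
  have h2 : (2 : K) ≠ 0 := Ring.two_ne_zero hK
  exact ⟨fun i => ⟨finrank_tableAlgebra, isCommJordan_J4 i, nilpotent_J4 i⟩,
    fun i j hij => not_isomorphic_J4 h2 hij,
    fun J _ _ _ _ _ hfin hJ => classified_of_nilpotent h2 hfin hJ,
    isomorphic_J4_prod, hasCentralComponent_J4_iff⟩
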